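/- Let $\mathcal H$ be a complex Hilbert space (not necessarily separable), let $\mathcal R$ be a set of pairwise commuting self-adjoint bounded operators on $\mathcal H$, and let $K$ be a positive operator on $\mathcal H$ of trace $1$, with associated normal state $\rho_K(A)=\operatorname{Tr}(KA)$ of $\mathfrak L(\mathcal H)$. Definitions. "Subalgebra" means unital $C^*$-subalgebra. A state $\omega$ of a unital $C^*$-algebra $\mathcal B$ is dispersion-free if $\omega(AX)=\omega(A)\omega(X)$ for all $A,X\in\mathcal B$. A subalgebra $\mathcal B\subseteq\mathfrak L(\mathcal H)$ is beable for a state $\rho$ of $\mathfrak L(\mathcal H)$ if there is a Borel probability measure $\mu$ on the space of dispersion-free states of $\mathcal B$ (with the weak-$*$ topology) such that $\rho(A)=\int\omega(A)\,d\mu(\omega)$ for all $A\in\mathcal B$. It is $\mathcal R$-beable for $\rho$ if it is beable for $\rho$, $\mathcal R\subseteq\mathcal B$, and $U\mathcal BU^*=\mathcal B$ for every unitary $U\in\mathcal R'$ such that $\rho(U^*AU)=\rho(A)$ for all $A\in\mathfrak L(\mathcal H)$. It is maximal $\mathcal R$-beable for $\rho$ if it is maximal under inclusion among the $\mathcal R$-beable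 subalgebras for $\rho$; "for $K$" means "for $\rho_K$". Write $[\,\cdot\,]$ for closed linear span, $P_{\mathcal S}$ for the orthogonal projection onto a closed subspace $\mathcal S$, $P_v=P_{[v]}$, and $\mathrm{vN}(\cdot)$ for the von Neumann algebra generated by a set of operators. For a set $\mathcal N$ of operators let $\mathfrak L(\mathcal S^\perp)\oplus \mathcal N P_{\mathcal S}=\{(I-P_{\mathcal S})X(I-P_{\mathcal S})+AP_{\mathcal S}: X\in\mathfrak L(\mathcal H),\ A\in\mathcal N\}$. (i) If $K\in\mathcal R'$, let $\mathcal S=[\mathcal R''\,\overline{\operatorname{ran}K}]$. Then $\mathfrak L(\mathcal S^\perp)\oplus \mathrm{vN}(\mathcal R,K)P_{\mathcal S}$ is a maximal $\mathcal R$-beable algebra for $K$, and it is the only one. (ii) If $K=P_v$ for some $v\in\mathcal H$, let $\mathcal S=[\mathcal R''v]$. Then $\mathfrak L(\mathcal S^\perp)\oplus \mathrm{vN}(\mathcal R)P_{\mathcal S}$ is a maximal $\mathcal R$-beable algebra for $K$, and it is the only one. -/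

import Mathlib

open scoped ComplexOrder InnerProductSpace

/-! ### States, dispersion-free states, beable subalgebras -/

section AbstractAlgebra

/-- The states of a unital `C⋆`-algebra `A`: the (continuous) linear functionals `ω` that are positive
and normalised, `ω 1 = 1`.  They are viewed inside the weak-`*` dual. -/
def stateSpace (A : Type*) [NormedRing A] [StarRing A] [NormedAlgebra ℂ A] :
    Set (WeakDual ℂ A) :=
  {ω | (∀ a : A, 0 ≤ ω (star a * a)) ∧ ω 1 = 1}

/-- The definite algebra `D_ω` of a functional `ω`. -/
def definiteAlgebra {A : Type*} [NormedRing A] [NormedAlgebra ℂ A] (ω : WeakDual ℂ A) : Set A :=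
  {a | ∀ x : A, ω (a * x) = ω a * ω x}

/-- The dispersion-free states of `A`: those states whose definite algebra is all of `A`. -/
def dispersionFreeStates (A : Type*) [NormedRing A] [StarRing A] [NormedAlgebra ℂ A] :
    Set (WeakDual ℂ A) :=
  {ω | ω ∈ stateSpace A ∧ ∀ a : A, a ∈ definiteAlgebra ω}

/-- The space of dispersion-free states carries the Borel `σ`-algebra of the weak-`*` topology. -/
noncomputable instance dispersionFreeStates.instMeasurableSpace
    (A : Type*) [NormedRing A] [StarRing A] [NormedAlgebra ℂ A] :
    MeasurableSpace (dispersionFreeStates A) :=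
  borel _

instance dispersionFreeStates.instBorelSpace
    (A : Type*) [NormedRing A] [StarRing A] [NormedAlgebra ℂ A] :
    BorelSpace (dispersionFreeStates A) :=
  ⟨rfl⟩

/-- The unital `C⋆`-subalgebra `B` of `A` (a norm-closed unital star-subalgebra) is beable for the
state `ρ` of `A`: the restriction of `ρ` to `B` is a mixture of dispersion-free states of `B`. -/
def IsBeable {A : Type*} [CStarAlgebra A] (ρ : stateSpace A) (B : StarSubalgebra ℂ A) : Prop :=
  IsClosed (B : Set A) ∧
    ∃ μ : MeasureTheory.Measure (dispersionFreeStates B),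
      MeasureTheory.IsProbabilityMeasure μ ∧
        ∀ b : B, (ρ : WeakDual ℂ A) (b : A) =
          ∫ ω : dispersionFreeStates B, (ω : WeakDual ℂ B) b ∂μ

/-- `B` is `R`-beable for the state `ρ`: it is beable for `ρ`, it contains `R`, and it is mapped onto
itself by every spatial automorphism `X ↦ U X U⋆`, with `U` a unitary of `A`, that fixes both `R` and
`ρ`. -/
structure IsRBeable {A : Type*} [CStarAlgebra A] (R : Set A) (ρ : stateSpace A)
    (B : StarSubalgebra ℂ A) : Prop where
  beable : IsBeable ρ B
  priv : R ⊆ (B : Set A)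
  definable : ∀ U ∈ unitary A, U ∈ Set.centralizer R →
    (∀ X : A, (ρ : WeakDual ℂ A) (star U * X * U) = (ρ : WeakDual ℂ A) X) →
      (fun X : A => U * X * star U) '' (B : Set A) = (B : Set A)

/-- `B` is maximal, with respect to inclusion, among the `R`-beable subalgebras for `ρ`. -/
def IsMaximalRBeable {A : Type*} [CStarAlgebra A] (R : Set A) (ρ : stateSpace A)
    (B : StarSubalgebra ℂ A) : Prop :=
  Maximal (IsRBeable R ρ) B

end AbstractAlgebra

/-! ### Normal states of `L(H)` -/

section NormalStates

variable {H : Type*} [NormedAddCommGroup H] [InnerProductSpace ℂ H] [CompleteSpace H]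

/-- The trace of an operator, computed in some Hilbert basis of `H` (for trace-class operators it does
not depend on the basis, see `IsDensityOperator.hasSum_inner`). -/
noncomputable def opTrace (T : H →L[ℂ] H) : ℂ :=
  ∑' i, ⟪(exists_hilbertBasis ℂ H).choose_spec.choose i,
    T ((exists_hilbertBasis ℂ H).choose_spec.choose i)⟫_ℂ

/-- Positive operators of trace one. A positive operator whose diagonal is not summable has
`opTrace` equal to `0`, so it is excluded. -/
def IsDensityOperator (K : H →L[ℂ] H) : Prop :=
  K.IsPositive ∧ opTrace K = 1

/-- Traces of `Q ∘ Q ∘ A`, for `Q` a self-adjoint operator that is square-summable on some Hilbert basis `c`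
(a Hilbert–Schmidt operator), can be computed in any Hilbert basis `b`. -/
theorem hasSum_inner_of_summable_sq {ι κ : Type*} (b : HilbertBasis ι ℂ H) (c : HilbertBasis κ ℂ H)
    (Q A : H →L[ℂ] H) (hQ : ∀ x y, ⟪Q x, y⟫_ℂ = ⟪x, Q y⟫_ℂ)
    (hs : Summable fun j => ‖Q (c j)‖ ^ 2) :
    HasSum (fun i => ⟪b i, Q (Q (A (b i)))⟫_ℂ) (∑' j, ⟪Q (c j), A (Q (c j))⟫_ℂ) := by
  have parseval : ∀ x : H, HasSum (fun i => ‖⟪b i, x⟫_ℂ‖ ^ 2) (‖x‖ ^ 2) := by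
    intro x
    have h := b.hasSum_inner_mul_inner x x
    have e : (fun i => ⟪x, b i⟫_ℂ * ⟪b i, x⟫_ℂ) = fun i => ((‖⟪b i, x⟫_ℂ‖ ^ 2 : ℝ) : ℂ) := by
      funext i
      rw [← inner_conj_symm x (b i), Complex.conj_mul']
      push_cast; rfl
    have e' : ⟪x, x⟫_ℂ = ((‖x‖ ^ 2 : ℝ) : ℂ) := by
      rw [inner_self_eq_norm_sq_to_K]; push_cast; rfl
    rw [e, e'] at h
    exact Complex.hasSum_ofReal.1 h
  have sumx : ∀ f : κ → H, (Summable fun j => ‖f j‖ ^ 2) →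
      Summable fun p : κ × ι => ‖⟪b p.2, f p.1⟫_ℂ‖ ^ 2 := by
    intro f hf
    rw [summable_prod_of_nonneg (fun _ => by positivity)]
    refine ⟨fun j => (parseval (f j)).summable, ?_⟩
    simpa only [(parseval (f _)).tsum_eq] using hf
  have hA : Summable fun j => ‖(star A) (Q (c j))‖ ^ 2 := by
    refine Summable.of_nonneg_of_le (fun _ => by positivity) (fun j => ?_)
      (hs.mul_left (‖star A‖ ^ 2))
    rw [← mul_pow]
    gcongr
    exact (star A).le_opNorm _
  have hF : Summable fun p : κ × ι => ⟪(star A) (Q (c p.1)), b p.2⟫_ℂ * ⟪b p.2, Q (c p.1)⟫_ℂ := by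
    refine Summable.of_norm_bounded ((sumx _ hA).add (sumx _ hs)) (fun p => ?_)
    rw [norm_mul, norm_inner_symm]
    nlinarith [sq_nonneg (‖⟪b p.2, (star A) (Q (c p.1))⟫_ℂ‖ - ‖⟪b p.2, Q (c p.1)⟫_ℂ‖),
      sq_nonneg (‖⟪b p.2, (star A) (Q (c p.1))⟫_ℂ‖), sq_nonneg (‖⟪b p.2, Q (c p.1)⟫_ℂ‖)]
  have h1 : ∀ j, HasSum (fun i => ⟪(star A) (Q (c j)), b i⟫_ℂ * ⟪b i, Q (c j)⟫_ℂ)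
      ⟪Q (c j), A (Q (c j))⟫_ℂ := by
    intro j
    have h := b.hasSum_inner_mul_inner ((star A) (Q (c j))) (Q (c j))
    rwa [ContinuousLinearMap.star_eq_adjoint, ContinuousLinearMap.adjoint_inner_left] at h
  have h2 : ∀ i, HasSum (fun j => ⟪(star A) (Q (c j)), b i⟫_ℂ * ⟪b i, Q (c j)⟫_ℂ)
      ⟪b i, Q (Q (A (b i)))⟫_ℂ := by
    intro i
    have h := c.hasSum_inner_mul_inner (Q (b i)) (Q (A (b i)))
    rw [hQ] at h
    refine Eq.subst (motive := fun f => HasSum f ⟪b i, Q (Q (A (b i)))⟫_ℂ) ?_ h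
    funext j
    symm
    rw [ContinuousLinearMap.star_eq_adjoint, ContinuousLinearMap.adjoint_inner_left, hQ, hQ, mul_comm]
  have h3 := hF.hasSum.prod_fiberwise h1
  have h4 := ((Equiv.prodComm ι κ).hasSum_iff.2 hF.hasSum).prod_fiberwise h2
  rw [h3.tsum_eq]
  exact h4

theorem IsDensityOperator.exists_sqrt {K : H →L[ℂ] H} (hK : IsDensityOperator K) :
    ∃ Q : H →L[ℂ] H, (∀ x y, ⟪Q x, y⟫_ℂ = ⟪x, Q y⟫_ℂ) ∧ (∀ x, K x = Q (Q x)) ∧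
      HasSum (fun j => ‖Q ((exists_hilbertBasis ℂ H).choose_spec.choose j)‖ ^ 2) 1 := by
  have h0 : 0 ≤ K := (ContinuousLinearMap.nonneg_iff_isPositive K).2 hK.1
  have hsq := CFC.sqrt_mul_sqrt_self K h0
  have hpos := (ContinuousLinearMap.nonneg_iff_isPositive _).1 (CFC.sqrt_nonneg K)
  refine ⟨CFC.sqrt K, fun x y => hpos.isSymmetric x y,
    fun x => (congrArg (fun T : H →L[ℂ] H => T x) hsq).symm, ?_⟩
  have ht := hK.2
  unfold opTrace at ht
  have hsum : Summable fun i => ⟪(exists_hilbertBasis ℂ H).choose_spec.choose i,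
      K ((exists_hilbertBasis ℂ H).choose_spec.choose i)⟫_ℂ := by
    by_contra h
    rw [tsum_eq_zero_of_not_summable h] at ht
    exact zero_ne_one ht
  have h1 := hsum.hasSum
  rw [ht] at h1
  have e : ∀ x : H, ⟪x, K x⟫_ℂ = ((‖(CFC.sqrt K) x‖ ^ 2 : ℝ) : ℂ) := by
    intro x
    rw [show K x = CFC.sqrt K (CFC.sqrt K x) from
      (congrArg (fun T : H →L[ℂ] H => T x) hsq).symm]
    refine (hpos.isSymmetric x (CFC.sqrt K x)).symm.trans ?_
    refine (inner_self_eq_norm_sq_to_K (𝕜 := ℂ) (CFC.sqrt K x)).trans ?_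
    push_cast; rfl
  simp only [e] at h1
  rw [← Complex.hasSum_ofReal]
  simpa using h1

/-- For a density operator `K`, the trace of `K A` is an unconditionally convergent sum with the same
value in every Hilbert basis. -/
theorem IsDensityOperator.hasSum_inner {K : H →L[ℂ] H} (hK : IsDensityOperator K)
    {ι : Type*} (b : HilbertBasis ι ℂ H) (A : H →L[ℂ] H) :
    HasSum (fun i => ⟪b i, (K * A) (b i)⟫_ℂ) (opTrace (K * A)) := by
  obtain ⟨Q, hQ, hKQ, hs⟩ := hK.exists_sqrt
  unfold opTrace
  simp only [mul_apply_eq_comp, hKQ]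
  rw [(hasSum_inner_of_summable_sq _ _ Q A hQ hs.summable).tsum_eq]
  exact hasSum_inner_of_summable_sq b _ Q A hQ hs.summable

theorem IsDensityOperator.exists_sandwich {K : H →L[ℂ] H} (hK : IsDensityOperator K) :
    ∃ (κ : Set H) (x : κ → H), HasSum (fun j => ‖x j‖ ^ 2) 1 ∧
      ∀ A : H →L[ℂ] H, HasSum (fun j => ⟪x j, A (x j)⟫_ℂ) (opTrace (K * A)) := by
  obtain ⟨Q, hQ, hKQ, hs⟩ := hK.exists_sqrt
  refine ⟨_, _, hs, fun A => ?_⟩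
  have hsum : Summable fun j => ⟪Q ((exists_hilbertBasis ℂ H).choose_spec.choose j),
      A (Q ((exists_hilbertBasis ℂ H).choose_spec.choose j))⟫_ℂ := by
    refine Summable.of_norm_bounded (hs.summable.mul_left ‖A‖) (fun j => ?_)
    refine (norm_inner_le_norm _ _).trans ?_
    rw [sq, mul_left_comm]
    gcongr
    exact A.le_opNorm _
  convert hsum.hasSum using 1
  unfold opTrace
  simp only [mul_apply_eq_comp, hKQ]
  exact (hasSum_inner_of_summable_sq _ _ Q A hQ hs.summable).tsum_eq

/-- The functional `A ↦ Tr (K A)` of a density operator `K`. -/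
noncomputable def traceFunctional (K : H →L[ℂ] H) (hK : IsDensityOperator K) :
    WeakDual ℂ (H →L[ℂ] H) :=
  StrongDual.toWeakDual <| LinearMap.mkContinuous
    { toFun := fun A => opTrace (K * A)
      map_add' := fun A B => by
        obtain ⟨κ, x, -, h⟩ := hK.exists_sandwich
        refine (h (A + B)).unique ?_
        simpa [inner_add_right] using (h A).add (h B)
      map_smul' := fun z A => by
        obtain ⟨κ, x, -, h⟩ := hK.exists_sandwich
        refine (h (z • A)).unique ?_
        simpa [inner_smul_right] using (h A).mul_left z }
    1 (fun A => by
      obtain ⟨κ, x, hx, h⟩ := hK.exists_sandwich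
      change ‖opTrace (K * A)‖ ≤ 1 * ‖A‖
      rw [← (h A).tsum_eq]
      refine tsum_of_norm_bounded (hx.mul_right ‖A‖) (fun j => ?_)
      refine (norm_inner_le_norm _ _).trans ?_
      rw [sq, mul_assoc, mul_comm (‖x j‖) ‖A‖]
      gcongr
      exact A.le_opNorm _)

theorem traceFunctional_apply (K : H →L[ℂ] H) (hK : IsDensityOperator K) (A : H →L[ℂ] H) :
    traceFunctional K hK A = opTrace (K * A) :=
  rfl

theorem traceFunctional_mem_stateSpace (K : H →L[ℂ] H) (hK : IsDensityOperator K) :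
    traceFunctional K hK ∈ stateSpace (H →L[ℂ] H) := by
  obtain ⟨κ, x, -, h⟩ := hK.exists_sandwich
  refine ⟨fun A => ?_, ?_⟩
  · rw [traceFunctional_apply]
    refine (h _).nonneg (fun j => ?_)
    rw [mul_apply_eq_comp, ContinuousLinearMap.star_eq_adjoint,
      ContinuousLinearMap.adjoint_inner_right]
    rw [inner_self_eq_norm_sq_to_K]
    change (0 : ℂ) ≤ ((‖A (x j)‖ : ℝ) : ℂ) ^ 2
    rw [← Complex.ofReal_pow]
    exact Complex.zero_le_real.2 (sq_nonneg _)
  · rw [traceFunctional_apply, mul_one, hK.2]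

/-- The normal state `A ↦ Tr (K A)` of `L(H)` defined by a positive trace-one operator `K`. -/
noncomputable def normalState (K : H →L[ℂ] H) (hK : IsDensityOperator K) :
    stateSpace (H →L[ℂ] H) :=
  ⟨traceFunctional K hK, traceFunctional_mem_stateSpace K hK⟩

/-! ### Generated von Neumann algebras, cyclic subspaces, direct sums -/

/-- `vN(R)`: the smallest von Neumann algebra on `H` that contains `R` (as a set of operators). -/
def vonNeumannGenerated (R : Set (H →L[ℂ] H)) : Set (H →L[ℂ] H) :=
  {T | ∀ M : VonNeumannAlgebra H, R ⊆ (M : Set (H →L[ℂ] H)) → T ∈ M}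

/-- `[R'' M]`: the closed linear span of the vectors `A x` with `A` in the double commutant of `R` and
`x ∈ M`. -/
abbrev bicommutantSpan (R : Set (H →L[ℂ] H)) (M : Set H) : Submodule ℂ H :=
  (Submodule.span ℂ
    {y : H | ∃ A ∈ Set.centralizer (Set.centralizer R), ∃ x ∈ M, y = A x}).topologicalClosure

/-- `L(Sᗮ) ⊕ N P_S`, as a set of operators on `H = Sᗮ ⊕ S`: all operators
`(1 - P_S) X (1 - P_S) + A P_S` with `X` an arbitrary bounded operator and `A ∈ N`. -/
def orthogonalSum (S : Submodule ℂ H) [S.HasOrthogonalProjection] (N : Set (H →L[ℂ] H)) :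
    Set (H →L[ℂ] H) :=
  {T | ∃ X : H →L[ℂ] H, ∃ A ∈ N,
    T = (1 - S.starProjection) * X * (1 - S.starProjection) + A * S.starProjection}

end NormalStates

/-! Both displayed algebras are greatest, not just maximal, among the `R`-beable ones.

Upper bound. A dispersion-free state is multiplicative with commuting values, so it kills
commutators. If `C` is beable for `K` and `a`, `x`, `y` lie in `C`, then `Z = (a * x - x * a) * y`
has `Tr (K Z⋆ Z) = 0`, hence `Z K = 0`. As `R ⊆ C`, commutators of `C` vanish on the cyclic subspace
`S` (`IsRBeable.commutator_mul_starProjection`). With `P = P_S`, the unitaries `z P + (1 - P)`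
commute with `R` and `K`; averaging over them puts the corner `(1 - P) T P` of `T ∈ C` in `C`, and
commutativity on `S` forces it to be `0`. So `S` reduces `C` (`IsRBeable.commute_starProjection`).
It remains to locate `T P`.

(i) For self-adjoint `T ∈ C`, `T P` commutes with all its conjugates by unitaries of `{R, K}'`.
Differentiating along `exp (i t b)` gives `[T P, [T P, b]] = 0`; using this for `b` and `b²` gives
`[T P, b]² = 0`, so `T P ∈ {R, K}''` (`mem_centralizer_centralizer_of_commute_conj`).

(ii) Commutators with `R ⊆ C` vanish on `S`, so `T P ∈ R'`. Since `v` is cyclic for the abelian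
algebra `R''` on `S`, the part of `R'` in `S` is abelian (`commute_of_cyclic`), and its elements
extend to `R''` (`exists_mem_bicommutant_mul_eq`).

Attainment. Compression to `S` maps the candidate onto a commutative algebra through which the state
factors, and states of commutative `C⋆`-algebras are mixtures of characters by Gelfand duality and
Riesz–Markov (`isBeable_of_reduces`). -/

/-! ### States of commutative `C⋆`-algebras as mixtures of characters -/

section RieszRepresentation

open MeasureTheory WeakDual

/-- The complex-valued function underlying a real-valued continuous function. -/
noncomputable def complexify {X : Type*} [TopologicalSpace X] (f : C(X, ℝ)) : C(X, ℂ) :=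
  ⟨fun x => (f x : ℂ), by fun_prop⟩

theorem complexify_apply {X : Type*} [TopologicalSpace X] (f : C(X, ℝ)) (x : X) :
    complexify f x = (f x : ℂ) := rfl

variable {A : Type*} [CommCStarAlgebra A]

/-- A nonnegative function is `star g * g` with `g` its square root. -/
theorem nonneg_gelfand_symm (σ : A →ₗ[ℂ] ℂ) (hσ : ∀ a, 0 ≤ σ (star a * a))
    (f : C(characterSpace ℂ A, ℝ)) (hf : 0 ≤ f) :
    0 ≤ σ ((gelfandStarTransform A).symm (complexify f)) := by
  let g : C(characterSpace ℂ A, ℝ) := ⟨fun x => Real.sqrt (f x), by fun_prop⟩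
  have hg : complexify f = star (complexify g) * complexify g := by
    ext x
    have : Real.sqrt (f x) * Real.sqrt (f x) = f x := Real.mul_self_sqrt (hf x)
    simp only [ContinuousMap.mul_apply, ContinuousMap.star_apply, complexify_apply, g,
      ContinuousMap.coe_mk, RCLike.star_def, Complex.conj_ofReal]
    rw [← Complex.ofReal_mul, this]
  rw [hg, map_mul, map_star]
  exact hσ _

/-- A positive functional on a commutative `C⋆`-algebra, on real continuous functions of the
characters. -/
noncomputable def realFunctional (σ : A →ₗ[ℂ] ℂ) : C(characterSpace ℂ A, ℝ) →ₗ[ℝ] ℝ where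
  toFun f := (σ ((gelfandStarTransform A).symm (complexify f))).re
  map_add' f g := by
    have : complexify (f + g) = complexify f + complexify g := by ext; simp [complexify_apply]
    rw [this, map_add, map_add, Complex.add_re]
  map_smul' r f := by
    have : complexify (r • f) = (r : ℂ) • complexify f := by ext; simp [complexify_apply]
    rw [this, map_smul, map_smul, smul_eq_mul, Complex.re_ofReal_mul]; rfl

theorem ofReal_realFunctional (σ : A →ₗ[ℂ] ℂ) (hσ : ∀ a, 0 ≤ σ (star a * a))
    (f : C(characterSpace ℂ A, ℝ)) :
    (realFunctional σ f : ℂ) = σ ((gelfandStarTransform A).symm (complexify f)) := by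
  have key : ∀ f : C(characterSpace ℂ A, ℝ), 0 ≤ f →
      (σ ((gelfandStarTransform A).symm (complexify f))).im = 0 := fun f hf =>
    (Complex.nonneg_iff.1 (nonneg_gelfand_symm σ hσ f hf)).2.symm
  -- Positive minus negative part: `σ` is already real on each.
  have h : complexify f = complexify (f ⊔ 0) - complexify ((-f) ⊔ 0) := by
    ext x
    simp only [complexify_apply, ContinuousMap.sub_apply, ContinuousMap.sup_apply,
      ContinuousMap.neg_apply, ContinuousMap.zero_apply, ← Complex.ofReal_sub]
    congr 1
    rcases le_total (f x) 0 with h | h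
    · rw [sup_of_le_right h, sup_of_le_left (by linarith)]; ring
    · rw [sup_of_le_left h, sup_of_le_right (by linarith)]; ring
  apply Complex.ext
  · rfl
  · rw [Complex.ofReal_im, h, map_sub, map_sub, Complex.sub_im, key _ le_sup_right,
      key _ le_sup_right, sub_zero]

/-- A state of a commutative `C⋆`-algebra is a mixture of characters. -/
theorem exists_measure_characterSpace [MeasurableSpace (characterSpace ℂ A)]
    [BorelSpace (characterSpace ℂ A)] (σ : A →ₗ[ℂ] ℂ)
    (hσ : ∀ a, 0 ≤ σ (star a * a)) (h1 : σ 1 = 1) :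
    ∃ μ : Measure (characterSpace ℂ A), IsProbabilityMeasure μ ∧
      ∀ a, σ a = ∫ φ : characterSpace ℂ A, φ a ∂μ := by
  let Λ : CompactlySupportedContinuousMap (characterSpace ℂ A) ℝ →ₚ[ℝ] ℝ :=
    PositiveLinearMap.mk₀
      { toFun := fun f => realFunctional σ f.toContinuousMap
        map_add' := fun f g => (realFunctional σ).map_add _ _
        map_smul' := fun r f => (realFunctional σ).map_smul _ _ }
      (fun f hf => (Complex.nonneg_iff.1 (nonneg_gelfand_symm σ hσ _ hf)).1)
  set μ := RealRMK.rieszMeasure Λ with hμ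
  have hint : ∀ f : C(characterSpace ℂ A, ℝ), ∫ x, f x ∂μ = realFunctional σ f := fun f =>
    RealRMK.integral_rieszMeasure Λ ⟨f, HasCompactSupport.of_compactSpace _⟩
  have hfin : IsFiniteMeasure μ := by infer_instance
  have hall : ∀ a, σ a = ∫ φ : characterSpace ℂ A, φ a ∂μ := by
    intro a
    -- The Riesz measure represents real functions only, so the transform of `a` is split into real
    -- and imaginary parts.
    let F := gelfandStarTransform A a
    let u : C(characterSpace ℂ A, ℝ) := ⟨fun x => (F x).re, by fun_prop⟩
    let w : C(characterSpace ℂ A, ℝ) := ⟨fun x => (F x).im, by fun_prop⟩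
    have hF : F = complexify u + Complex.I • complexify w := by
      ext x
      simp only [ContinuousMap.add_apply, ContinuousMap.smul_apply, complexify_apply, u, w,
        ContinuousMap.coe_mk, smul_eq_mul]
      rw [mul_comm, Complex.re_add_im]
    have ha : a = (gelfandStarTransform A).symm F := by simp [F]
    have e : ∀ φ : characterSpace ℂ A, φ a = (u φ : ℂ) + Complex.I * (w φ : ℂ) := by
      intro φ
      change F φ = _
      rw [hF]; rfl
    have i1 : Integrable (fun φ => (u φ : ℂ)) μ :=
      (complexify u).continuous.integrable_of_hasCompactSupport
        (HasCompactSupport.of_compactSpace _)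
    have i2 : Integrable (fun φ => (w φ : ℂ)) μ :=
      (complexify w).continuous.integrable_of_hasCompactSupport
        (HasCompactSupport.of_compactSpace _)
    simp only [e]
    rw [integral_add i1 (i2.const_mul _), integral_const_mul, integral_complex_ofReal,
      integral_complex_ofReal, hint, hint, ofReal_realFunctional σ hσ, ofReal_realFunctional σ hσ]
    conv_lhs => rw [ha, hF]
    rw [map_add, map_add, map_smul, map_smul, smul_eq_mul]
  refine ⟨μ, ⟨?_⟩, hall⟩
  have h := hall 1
  rw [h1] at h
  simp only [map_one, integral_const] at h
  have h' : μ.real Set.univ = 1 := by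
    have : ((μ.real Set.univ : ℝ) : ℂ) = 1 := by rw [h]; simp
    exact_mod_cast this
  rw [Measure.real, ENNReal.toReal_eq_one_iff] at h'
  exact h'

end RieszRepresentation

/-! ### Beability and commutators -/

section Beable

open MeasureTheory WeakDual

/-- A closed star subalgebra with a homomorphism to a commutative `C⋆`-algebra through which the
restricted state factors is beable. -/
theorem isBeable_of_factor {A D : Type*} [CStarAlgebra A] [CommCStarAlgebra D] (ρ : stateSpace A)
    (B : StarSubalgebra ℂ A) (hB : IsClosed (B : Set A)) (π : B →⋆ₐ[ℂ] D) (hπ : Continuous π)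
    (σ : D →ₗ[ℂ] ℂ) (hσ : ∀ d, 0 ≤ σ (star d * d))
    (h : ∀ b : B, (ρ : WeakDual ℂ A) (b : A) = σ (π b)) : IsBeable ρ B := by
  let _ : MeasurableSpace (characterSpace ℂ D) := borel _
  have : BorelSpace (characterSpace ℂ D) := ⟨rfl⟩
  have h1 : σ 1 = 1 := by
    have := h 1
    rw [map_one] at this
    rw [← this]
    exact ρ.2.2
  obtain ⟨μ, hμ, hμσ⟩ := exists_measure_characterSpace σ hσ h1
  -- Characters of `D` pull back along `π` to dispersion-free states of `B`; the map is weak-`*`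
  -- continuous, so the mixing measure can be pushed forward.
  let pull : characterSpace ℂ D → WeakDual ℂ B := fun χ =>
    StrongDual.toWeakDual
      (ContinuousLinearMap.mk ((χ : WeakDual ℂ D).toLinearMap ∘ₗ π.toAlgHom.toLinearMap)
        ((map_continuous χ).comp hπ))
  have pull_apply : ∀ χ b, pull χ b = χ (π b) := fun _ _ => rfl
  have pull_mem : ∀ χ, pull χ ∈ dispersionFreeStates B := by
    intro χ
    refine ⟨⟨fun b => ?_, ?_⟩, fun b x => ?_⟩
    · rw [pull_apply, map_mul, map_mul, map_star, map_star]
      exact star_mul_self_nonneg _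
    · rw [pull_apply, map_one, map_one]
    · rw [pull_apply, pull_apply, pull_apply, map_mul, map_mul]
  let F : characterSpace ℂ D → dispersionFreeStates B := fun χ => ⟨pull χ, pull_mem χ⟩
  have hF : Continuous F := by
    refine Continuous.subtype_mk ?_ _
    refine WeakDual.continuous_of_continuous_eval fun b => ?_
    exact (WeakDual.eval_continuous (π b)).comp continuous_subtype_val
  refine ⟨hB, μ.map F, Measure.isProbabilityMeasure_map hF.measurable.aemeasurable, fun b => ?_⟩
  rw [integral_map hF.measurable.aemeasurable, h, hμσ]
  · rfl
  · exact ((WeakDual.eval_continuous b).comp continuous_subtype_val).aestronglyMeasurable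

/-- A closed star subalgebra with a homomorphism with commutative range through which the
restricted state factors is beable. -/
theorem isBeable_of_commute_range {A D : Type*} [CStarAlgebra A] [CStarAlgebra D]
    (ρ : stateSpace A) (B : StarSubalgebra ℂ A) (hB : IsClosed (B : Set A)) (π : B →⋆ₐ[ℂ] D)
    (hπ : Continuous π) (hcomm : ∀ b b', π b * π b' = π b' * π b)
    (σ : D →ₗ[ℂ] ℂ) (hσ : ∀ d, 0 ≤ σ (star d * d))
    (h : ∀ b : B, (ρ : WeakDual ℂ A) (b : A) = σ (π b)) : IsBeable ρ B := by
  have hrange : ∀ x y : π.range, x * y = y * x := by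
    rintro ⟨_, T, rfl⟩ ⟨_, T', rfl⟩
    exact Subtype.ext (hcomm T T')
  let E := π.range.topologicalClosure
  have hE : IsClosed (E : Set D) := π.range.isClosed_topologicalClosure
  let _ : CommCStarAlgebra E :=
    { StarSubalgebra.cstarAlgebra E with
      mul_comm := (π.range.commRingTopologicalClosure hrange).mul_comm }
  let π' : B →⋆ₐ[ℂ] E := π.codRestrict E fun T => π.range.le_topologicalClosure ⟨T, rfl⟩
  have hπ' : Continuous π' := hπ.subtype_mk _
  exact isBeable_of_factor ρ B hB π' hπ' (σ ∘ₗ E.subtype.toAlgHom.toLinearMap)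
    (fun d => hσ d) h

/-- On a beable subalgebra, products with a commutator are null for the state. -/
theorem IsBeable.apply_commutator {A : Type*} [CStarAlgebra A] {ρ : stateSpace A}
    {B : StarSubalgebra ℂ A} (h : IsBeable ρ B) {a x y : A} (ha : a ∈ B) (hx : x ∈ B)
    (hy : y ∈ B) :
    (ρ : WeakDual ℂ A) (star ((a * x - x * a) * y) * ((a * x - x * a) * y)) = 0 := by
  obtain ⟨-, μ, -, hμ⟩ := h
  let a' : B := ⟨a, ha⟩
  let x' : B := ⟨x, hx⟩
  let y' : B := ⟨y, hy⟩
  have := hμ (star ((a' * x' - x' * a') * y') * ((a' * x' - x' * a') * y'))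
  refine this.trans ?_
  refine (integral_congr_ae (Filter.Eventually.of_forall fun ω => ?_)).trans
    (integral_zero _ _)
  -- Multiplicativity turns the integrand into a product of complex numbers with a vanishing
  -- commutator factor.
  have hm : ∀ p q : B, (ω : WeakDual ℂ B) (p * q) = (ω : WeakDual ℂ B) p * (ω : WeakDual ℂ B) q :=
    fun p q => ω.2.2 p q
  simp only [hm, map_sub]
  ring

end Beable

/-! ### Density operators and the symmetries of their states -/

section DensityOperators

variable {H : Type*} [NormedAddCommGroup H] [InnerProductSpace ℂ H] [CompleteSpace H]

/-- Invariance under `X` gives `P X P = X P`; invariance under `star X` gives, after adjoints, `P X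
P = P X`. -/
theorem commute_starProjection {S : Submodule ℂ H} [S.HasOrthogonalProjection] {X : H →L[ℂ] H}
    (hX : ∀ x ∈ S, X x ∈ S) (hX' : ∀ x ∈ S, (star X) x ∈ S) : Commute X S.starProjection := by
  have key : ∀ Y : H →L[ℂ] H, (∀ x ∈ S, Y x ∈ S) →
      S.starProjection * Y * S.starProjection = Y * S.starProjection := fun Y hY => by
    ext x
    simp only [mul_apply_eq_comp]
    exact Submodule.starProjection_eq_self_iff.2 (hY _ (Submodule.starProjection_apply_mem _ _))
  have hP : star S.starProjection = S.starProjection := isSelfAdjoint_starProjection S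
  have h1 := key X hX
  have h2 := congrArg star (key (star X) hX')
  simp only [star_mul, star_star, hP] at h2
  change X * _ = _ * X
  rw [← h1, mul_assoc, h2]

theorem star_rankOne_conj (U : H →L[ℂ] H) (x y : H) :
    star U * InnerProductSpace.rankOne ℂ x y * U =
      InnerProductSpace.rankOne ℂ (star U x) (star U y) := by
  ext z
  simp only [mul_apply_eq_comp, InnerProductSpace.rankOne_apply, map_smul]
  rw [ContinuousLinearMap.star_eq_adjoint, ContinuousLinearMap.adjoint_inner_left]

theorem IsDensityOperator.opTrace_mul_rankOne {K : H →L[ℂ] H} (hK : IsDensityOperator K)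
    (x y : H) : opTrace (K * InnerProductSpace.rankOne ℂ x y) = ⟪y, K x⟫_ℂ := by
  obtain ⟨w, b, hb⟩ := exists_hilbertBasis ℂ H
  refine (hK.hasSum_inner b _).unique ?_
  have e : (fun i => ⟪b i, (K * InnerProductSpace.rankOne ℂ x y) (b i)⟫_ℂ) =
      fun i => ⟪y, b i⟫_ℂ * ⟪b i, K x⟫_ℂ := by
    funext i
    simp [mul_apply_eq_comp]
  rw [e]
  exact b.hasSum_inner_mul_inner y (K x)

/-- With `K = Q²`, the trace is the sum of `‖Z Q c_j‖²` over a basis, so `Z Q = 0` and then `Z K = Z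
Q Q = 0`. -/
theorem IsDensityOperator.mul_eq_zero_of_opTrace {K : H →L[ℂ] H} (hK : IsDensityOperator K)
    {Z : H →L[ℂ] H} (hZ : opTrace (K * (star Z * Z)) = 0) : Z * K = 0 := by
  obtain ⟨Q, hQ, hKQ, hs⟩ := hK.exists_sqrt
  set c := (exists_hilbertBasis ℂ H).choose_spec.choose
  have hterm : ∀ j, ⟪Q (c j), (star Z * Z) (Q (c j))⟫_ℂ = ((‖Z (Q (c j))‖ ^ 2 : ℝ) : ℂ) := by
    intro j
    rw [mul_apply_eq_comp, ContinuousLinearMap.star_eq_adjoint,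
      ContinuousLinearMap.adjoint_inner_right, inner_self_eq_norm_sq_to_K]
    push_cast; rfl
  have hsum : Summable fun j => ‖Z (Q (c j))‖ ^ 2 := by
    refine Summable.of_nonneg_of_le (fun _ => by positivity) (fun j => ?_)
      (hs.summable.mul_left (‖Z‖ ^ 2))
    rw [← mul_pow]
    gcongr
    exact Z.le_opNorm _
  have htr : opTrace (K * (star Z * Z)) = ∑' j, ⟪Q (c j), (star Z * Z) (Q (c j))⟫_ℂ := by
    unfold opTrace
    simp only [mul_apply_eq_comp, hKQ]
    have := (hasSum_inner_of_summable_sq c c Q (star Z * Z) hQ hs.summable).tsum_eq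
    simpa only [mul_apply_eq_comp] using this
  rw [htr] at hZ
  simp only [hterm] at hZ
  rw [← Complex.ofReal_tsum, Complex.ofReal_eq_zero] at hZ
  have h0 := (hsum.hasSum_iff.2 hZ)
  rw [hasSum_zero_iff_of_nonneg (fun _ => by positivity)] at h0
  have hZQ : Z * Q = 0 := by
    have hd : ∀ x : H, x ∈ (Submodule.span ℂ (Set.range c)).topologicalClosure → (Z * Q) x = 0 := by
      intro x hx
      have hle : (Submodule.span ℂ (Set.range c)).topologicalClosure ≤ (Z * Q).ker := by
        refine Submodule.topologicalClosure_minimal _ (Submodule.span_le.2 ?_)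
          (Z * Q).isClosed_ker
        rintro _ ⟨j, rfl⟩
        have := congrFun h0 j
        simpa using this
      exact hle hx
    ext x
    exact hd x (by rw [c.dense_span]; trivial)
  ext x
  rw [mul_apply_eq_comp, hKQ]
  exact congrArg (fun T : H →L[ℂ] H => T (Q x)) hZQ

theorem normalState_apply (K : H →L[ℂ] H) (hK : IsDensityOperator K) (A : H →L[ℂ] H) :
    (normalState K hK : WeakDual ℂ (H →L[ℂ] H)) A = opTrace (K * A) := rfl

theorem IsDensityOperator.isSelfAdjoint {K : H →L[ℂ] H} (hK : IsDensityOperator K) :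
    IsSelfAdjoint K := hK.1.isSelfAdjoint

/-- A unitary that preserves the normal state of `K` commutes with `K`. -/
theorem IsDensityOperator.commute_of_invariant {K : H →L[ℂ] H} (hK : IsDensityOperator K)
    {U : H →L[ℂ] H} (hU : U ∈ unitary (H →L[ℂ] H))
    (h : ∀ X : H →L[ℂ] H, (normalState K hK : WeakDual ℂ (H →L[ℂ] H)) (star U * X * U) =
      (normalState K hK : WeakDual ℂ (H →L[ℂ] H)) X) : Commute U K := by
  have h1 : U * K * star U = K := by
    ext x
    refine ext_inner_left ℂ fun y => ?_
    -- Rank-one operators read off the matrix elements of `K` from its state.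
    have := h (InnerProductSpace.rankOne ℂ x y)
    rw [star_rankOne_conj, normalState_apply, normalState_apply, hK.opTrace_mul_rankOne,
      hK.opTrace_mul_rankOne, ContinuousLinearMap.star_eq_adjoint,
      ContinuousLinearMap.adjoint_inner_left] at this
    exact this
  change U * K = K * U
  conv_rhs => rw [← h1]
  rw [mul_assoc _ _ U, Unitary.star_mul_self_of_mem hU, mul_one]

/-- A unitary that commutes with `K` preserves the normal state of `K`. -/
theorem IsDensityOperator.invariant_of_commute {K : H →L[ℂ] H} (hK : IsDensityOperator K)
    {U : H →L[ℂ] H} (hU : U ∈ unitary (H →L[ℂ] H)) (h : Commute U K) (X : H →L[ℂ] H) :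
    (normalState K hK : WeakDual ℂ (H →L[ℂ] H)) (star U * X * U) =
      (normalState K hK : WeakDual ℂ (H →L[ℂ] H)) X := by
  obtain ⟨w, b, hb⟩ := exists_hilbertBasis ℂ H
  let e : H ≃ₗᵢ[ℂ] H := Unitary.linearIsometryEquiv ⟨U, hU⟩
  -- Conjugating by `U` amounts to computing the trace in the rotated basis `U b`.
  let b' : HilbertBasis w ℂ H := HilbertBasis.ofRepr (e.symm.trans b.repr)
  have hb' : ∀ i, b' i = U (b i) := fun i => rfl
  rw [normalState_apply, normalState_apply]
  refine (hK.hasSum_inner b _).unique ?_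
  convert hK.hasSum_inner b' X using 2 with i
  have h' : star U * K = K * star U := by
    have := congrArg star h.eq
    simpa only [star_mul, hK.isSelfAdjoint.star_eq] using this.symm
  rw [hb', ← mul_assoc, ← mul_assoc, ← h', mul_assoc, mul_assoc, mul_apply_eq_comp,
    ContinuousLinearMap.star_eq_adjoint, ContinuousLinearMap.adjoint_inner_right]
  rfl

end DensityOperators

/-! ### Compression to a reducing subspace -/

section Compression

variable {H : Type*} [NormedAddCommGroup H] [InnerProductSpace ℂ H] 

/-- The compression of an operator to a closed subspace. -/
noncomputable def compression (S : Submodule ℂ H) [CompleteSpace S] (T : H →L[ℂ] H) :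
    S →L[ℂ] S :=
  S.orthogonalProjectionOnto ∘L T ∘L S.subtypeL

theorem coe_compression_apply (S : Submodule ℂ H) [CompleteSpace S] (T : H →L[ℂ] H) (x : S) :
    (compression S T x : H) = S.starProjection (T x) := rfl

theorem continuous_compression (S : Submodule ℂ H) [CompleteSpace S] :
    Continuous (compression S) := by
  unfold compression; fun_prop

/-- The extension by zero of an operator on a closed subspace. -/
noncomputable def extendZero (S : Submodule ℂ H) [CompleteSpace S] :
    (S →L[ℂ] S) →ₗ[ℂ] (H →L[ℂ] H) where
  toFun X := S.subtypeL ∘L X ∘L S.orthogonalProjectionOnto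
  map_add' X Y := by ext; simp
  map_smul' c X := by ext; simp

theorem extendZero_compression (S : Submodule ℂ H) [CompleteSpace S] (T : H →L[ℂ] H) :
    extendZero S (compression S T) = S.starProjection * T * S.starProjection := rfl

variable [CompleteSpace H]

/-- The compression to a reducing subspace, as a homomorphism. -/
noncomputable def compressionHom (S : Submodule ℂ H) [CompleteSpace S]
    (B : StarSubalgebra ℂ (H →L[ℂ] H)) (hB : ∀ T ∈ B, Commute T S.starProjection) :
    B →⋆ₐ[ℂ] (S →L[ℂ] S) where
  toFun T := compression S T
  map_one' := by
    ext x
    simp [coe_compression_apply]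
  map_mul' T T' := by
    ext x
    have h := congrArg (fun A : H →L[ℂ] H => A x) (hB T T.2).eq
    have h' := congrArg (fun A : H →L[ℂ] H => A x) (hB T' T'.2).eq
    simp only [mul_apply_eq_comp, Submodule.starProjection_mem_subspace_eq_self] at h h'
    simp only [mul_apply_eq_comp, coe_compression_apply, MulMemClass.coe_mul]
    rw [← h']
  map_zero' := by
    ext x
    simp [coe_compression_apply]
  map_add' T T' := by
    ext x
    simp [coe_compression_apply]
  commutes' r := by
    ext x
    simp [coe_compression_apply, Algebra.algebraMap_eq_smul_one]
  map_star' T := by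
    simp only [compression, ContinuousLinearMap.star_eq_adjoint, ContinuousLinearMap.adjoint_comp,
      Submodule.adjoint_subtypeL, Submodule.adjoint_orthogonalProjectionOnto, StarMemClass.coe_star,
      ContinuousLinearMap.comp_assoc]

theorem extendZero_star_mul (S : Submodule ℂ H) [CompleteSpace S] (X : S →L[ℂ] S) :
    extendZero S (star X * X) = star (extendZero S X) * extendZero S X := by
  simp only [extendZero, LinearMap.coe_mk, AddHom.coe_mk, ContinuousLinearMap.star_eq_adjoint,
    ContinuousLinearMap.adjoint_comp, Submodule.adjoint_subtypeL,
    Submodule.adjoint_orthogonalProjectionOnto]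
  ext x
  simp

/-- A closed star subalgebra that is reduced by a subspace supporting `K` and commutative on it is
beable for `K`. -/
theorem isBeable_of_reduces {K : H →L[ℂ] H} (hK : IsDensityOperator K) (S : Submodule ℂ H)
    [CompleteSpace S] (hKS : K * S.starProjection = K)
    (B : StarSubalgebra ℂ (H →L[ℂ] H)) (hcl : IsClosed (B : Set (H →L[ℂ] H)))
    (hB : ∀ T ∈ B, Commute T S.starProjection)
    (hcomm : ∀ T ∈ B, ∀ T' ∈ B, Commute (T * S.starProjection) (T' * S.starProjection)) :
    IsBeable (normalState K hK) B := by
  refine isBeable_of_commute_range (D := S →L[ℂ] S) (normalState K hK) B hcl (compressionHom S B hB)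
    ((continuous_compression S).comp continuous_subtype_val) (fun T T' => ?_)
    ((normalState K hK : WeakDual ℂ (H →L[ℂ] H)).toLinearMap ∘ₗ extendZero S)
    (fun d => ?_) (fun T => ?_)
  · rw [← map_mul, ← map_mul]
    ext x
    have h := congrArg (fun A : H →L[ℂ] H => A x) (hcomm T T.2 T' T'.2).eq
    have hT := congrArg (fun A : H →L[ℂ] H => A x) (hB T T.2).eq
    have hT' := congrArg (fun A : H →L[ℂ] H => A x) (hB T' T'.2).eq
    simp only [mul_apply_eq_comp, Submodule.starProjection_mem_subspace_eq_self] at h hT hT'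
    rw [← hT, ← hT'] at h
    exact congrArg S.starProjection h
  · change 0 ≤ (normalState K hK : WeakDual ℂ (H →L[ℂ] H)) (extendZero S (star d * d))
    rw [extendZero_star_mul]
    exact (normalState K hK).2.1 _
  · change _ = (normalState K hK : WeakDual ℂ (H →L[ℂ] H)) (extendZero S (compression S T))
    -- Reduction gives `P T P = P T`, and `K P = K` then removes `P` under the trace.
    have hP : S.starProjection * S.starProjection = S.starProjection :=
      S.isIdempotentElem_starProjection
    rw [extendZero_compression, mul_assoc, (hB T T.2).eq, ← mul_assoc, hP, normalState_apply,
      normalState_apply, ← mul_assoc, hKS]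

end Compression

/-! ### Commutants, cyclic subspaces and direct sums -/

section Commutants

variable {H : Type*} [NormedAddCommGroup H] [InnerProductSpace ℂ H] [CompleteSpace H]

theorem coe_starSubalgebra_centralizer {Z : Set (H →L[ℂ] H)} (hZ : ∀ A ∈ Z, star A ∈ Z) :
    (StarSubalgebra.centralizer ℂ Z : Set (H →L[ℂ] H)) = Z.centralizer := by
  rw [StarSubalgebra.coe_centralizer]
  congr 1
  exact Set.union_eq_left.2 fun A hA => star_star A ▸ hZ _ hA

/-- `Z''` is a von Neumann algebra because `Z''' = Z'`, and any `M ⊇ Z` satisfies `M = M'' ⊇ Z''`.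
-/
theorem vonNeumannGenerated_eq {Z : Set (H →L[ℂ] H)} (hZ : ∀ A ∈ Z, star A ∈ Z) :
    vonNeumannGenerated Z = Z.centralizer.centralizer := by
  have hZ' : ∀ A ∈ Z.centralizer, star A ∈ Z.centralizer := fun A hA =>
    Set.star_mem_centralizer' hZ hA
  have hcoe := coe_starSubalgebra_centralizer hZ'
  apply Set.Subset.antisymm
  · intro T hT
    let M : VonNeumannAlgebra H :=
      { StarSubalgebra.centralizer ℂ Z.centralizer with
        centralizer_centralizer' := by
          change (StarSubalgebra.centralizer ℂ Z.centralizer :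
            Set (H →L[ℂ] H)).centralizer.centralizer = StarSubalgebra.centralizer ℂ Z.centralizer
          rw [hcoe, Set.centralizer_centralizer_centralizer] }
    have hM : (M : Set (H →L[ℂ] H)) = Z.centralizer.centralizer := hcoe
    have := hT M (hM ▸ Set.subset_centralizer_centralizer)
    rwa [← SetLike.mem_coe, hM] at this
  · intro T hT M hM
    rw [← SetLike.mem_coe, ← M.centralizer_centralizer]
    exact Set.centralizer_subset (Set.centralizer_subset hM) hT

variable {R : Set (H →L[ℂ] H)} {M : Set H}

theorem apply_mem_bicommutantSpan {A : H →L[ℂ] H} (hA : A ∈ R.centralizer.centralizer) {x : H}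
    (hx : x ∈ M) : A x ∈ bicommutantSpan R M :=
  Submodule.le_topologicalClosure _ (Submodule.subset_span ⟨A, hA, x, hx, rfl⟩)

theorem subset_bicommutantSpan : M ⊆ bicommutantSpan R M := fun _ hx =>
  apply_mem_bicommutantSpan (A := 1) Set.one_mem_centralizer hx

theorem bicommutantSpan_le_of_forall {V : Submodule ℂ H} (hV : IsClosed (V : Set H))
    (h : ∀ A ∈ R.centralizer.centralizer, ∀ x ∈ M, A x ∈ V) : bicommutantSpan R M ≤ V := by
  refine Submodule.topologicalClosure_minimal _ (Submodule.span_le.2 ?_) hV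
  rintro _ ⟨A, hA, x, hx, rfl⟩
  exact h A hA x hx

theorem bicommutantSpan_le_comap {X : H →L[ℂ] H}
    (h : ∀ A ∈ R.centralizer.centralizer, ∀ x ∈ M, X (A x) ∈ bicommutantSpan R M) :
    ∀ y ∈ bicommutantSpan R M, X y ∈ bicommutantSpan R M := by
  have hcl : IsClosed ((bicommutantSpan R M).comap (X : H →ₗ[ℂ] H) : Set H) :=
    (Submodule.isClosed_topologicalClosure _).preimage X.continuous
  exact fun y hy => bicommutantSpan_le_of_forall (M := M) hcl h hy

theorem starProjection_bicommutantSpan_mem_centralizer (hR : ∀ A ∈ R, IsSelfAdjoint A) :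
    (bicommutantSpan R M).starProjection ∈ R.centralizer := by
  intro A hA
  have key : ∀ y ∈ bicommutantSpan R M, A y ∈ bicommutantSpan R M := by
    refine bicommutantSpan_le_comap fun B hB x hx => ?_
    exact apply_mem_bicommutantSpan
      (Set.mul_mem_centralizer (Set.subset_centralizer_centralizer hA) hB) hx
  exact commute_starProjection key (by rwa [(hR A hA).star_eq])

/-- The cyclic subspace is the least closed subspace invariant under `R` that contains `M`. -/
theorem bicommutantSpan_le (hR : ∀ A ∈ R, IsSelfAdjoint A) {V : Submodule ℂ H}
    (hV : IsClosed (V : Set H)) (hM : M ⊆ V) (hinv : ∀ A ∈ R, ∀ x ∈ V, A x ∈ V) :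
    bicommutantSpan R M ≤ V := by
  have : CompleteSpace V := hV.completeSpace_coe
  -- The projection onto `V` lies in `R'`, so `R''` commutes with it and preserves `V`.
  have hP : V.starProjection ∈ R.centralizer := fun A hA =>
    commute_starProjection (hinv A hA) (by rw [(hR A hA).star_eq]; exact hinv A hA)
  refine bicommutantSpan_le_of_forall hV fun A hA x hx => ?_
  have h := congrArg (fun T : H →L[ℂ] H => T x) (hA _ hP)
  simp only [mul_apply_eq_comp] at h
  rw [← Submodule.starProjection_eq_self_iff.2 (hM hx), ← h]
  exact Submodule.starProjection_apply_mem _ _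

theorem starProjection_mul_of_range_subset {S : Submodule ℂ H} [S.HasOrthogonalProjection]
    {K : H →L[ℂ] H} (h : Set.range K ⊆ S) : S.starProjection * K = K := by
  ext x
  exact Submodule.starProjection_eq_self_iff.2 (h ⟨x, rfl⟩)

theorem mul_starProjection_of_range_subset {S : Submodule ℂ H} [S.HasOrthogonalProjection]
    {K : H →L[ℂ] H} (hK : IsSelfAdjoint K) (h : Set.range K ⊆ S) : K * S.starProjection = K := by
  have h' := congrArg star (starProjection_mul_of_range_subset h)
  rwa [star_mul, hK.star_eq, (isSelfAdjoint_starProjection S).star_eq] at h'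

/-- The operators that are reduced by a subspace and whose part in it lies in a given algebra. -/
noncomputable def reducedBy (S : Submodule ℂ H) [S.HasOrthogonalProjection]
    (N : StarSubalgebra ℂ (H →L[ℂ] H)) (hN : S.starProjection ∈ N) :
    StarSubalgebra ℂ (H →L[ℂ] H) where
  carrier := {T | Commute T S.starProjection ∧ T * S.starProjection ∈ N}
  mul_mem' := by
    rintro A B ⟨hA, hA'⟩ ⟨hB, hB'⟩
    refine ⟨hA.mul_left hB, ?_⟩
    have hP : S.starProjection * S.starProjection = S.starProjection :=
      S.isIdempotentElem_starProjection
    have : A * B * S.starProjection = A * S.starProjection * (B * S.starProjection) := by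
      rw [mul_assoc A S.starProjection, ← mul_assoc S.starProjection, ← hB.eq, mul_assoc B, hP,
        mul_assoc]
    rw [this]
    exact mul_mem hA' hB'
  add_mem' := by
    rintro A B ⟨hA, hA'⟩ ⟨hB, hB'⟩
    exact ⟨hA.add_left hB, by rw [add_mul]; exact add_mem hA' hB'⟩
  algebraMap_mem' r := by
    refine ⟨Algebra.commutes r _, ?_⟩
    rw [← Algebra.smul_def]
    exact N.smul_mem hN r
  star_mem' := by
    rintro A ⟨hA, hA'⟩
    have hP : star S.starProjection = S.starProjection := isSelfAdjoint_starProjection S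
    have h : Commute (star A) S.starProjection := by
      have := hA.star_star
      rwa [hP] at this
    refine ⟨h, ?_⟩
    have := star_mem hA'
    rwa [star_mul, hP, ← h.eq] at this

theorem isClosed_reducedBy {S : Submodule ℂ H} [S.HasOrthogonalProjection]
    {N : StarSubalgebra ℂ (H →L[ℂ] H)} {hN : S.starProjection ∈ N}
    (hcl : IsClosed (N : Set (H →L[ℂ] H))) :
    IsClosed (reducedBy S N hN : Set (H →L[ℂ] H)) := by
  have h : (reducedBy S N hN : Set (H →L[ℂ] H)) =
      {T | T * S.starProjection = S.starProjection * T} ∩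
        (fun T => T * S.starProjection) ⁻¹' (N : Set (H →L[ℂ] H)) := rfl
  rw [h]
  exact (isClosed_eq (by fun_prop) (by fun_prop)).inter (hcl.preimage (by fun_prop))

/-- The part of the direct sum in `S` may be chosen in any set with the same restrictions to `S`. -/
theorem coe_reducedBy_eq_orthogonalSum {S : Submodule ℂ H} [S.HasOrthogonalProjection]
    {N : StarSubalgebra ℂ (H →L[ℂ] H)} {hN : S.starProjection ∈ N} {L : Set (H →L[ℂ] H)}
    (hL : ∀ A ∈ L, Commute A S.starProjection ∧ A * S.starProjection ∈ N)
    (hNL : ∀ T ∈ N, T * S.starProjection = T → S.starProjection * T = T →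
      ∃ A ∈ L, A * S.starProjection = T) :
    (reducedBy S N hN : Set (H →L[ℂ] H)) = orthogonalSum S L := by
  have hP : S.starProjection * S.starProjection = S.starProjection :=
    S.isIdempotentElem_starProjection
  set P := S.starProjection
  have hPQ : (1 - P) * P = 0 := by rw [sub_mul, one_mul, hP, sub_self]
  have hQP : P * (1 - P) = 0 := by rw [mul_sub, mul_one, hP, sub_self]
  ext T
  constructor
  · rintro ⟨hT, hT'⟩
    obtain ⟨A, hA, hAT⟩ := hNL _ hT' (by rw [mul_assoc, hP])
      (by rw [← mul_assoc, ← hT.eq, mul_assoc, hP])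
    -- `T` itself serves as `X`: being reduced, it is the sum of its two diagonal parts.
    refine ⟨T, A, hA, ?_⟩
    change T = (1 - P) * T * (1 - P) + A * P
    have hQT : (1 - P) * T = T * (1 - P) := by
      rw [sub_mul, mul_sub, one_mul, mul_one]; exact congrArg _ hT.eq.symm
    have hQQ : (1 - P) * (1 - P) = 1 - P := by rw [mul_sub, hPQ, mul_one, sub_zero]
    rw [hAT, hQT, mul_assoc, hQQ, mul_sub, mul_one, sub_add_cancel]
  · rintro ⟨X, A, hA, rfl⟩
    obtain ⟨hAP, hAN⟩ := hL A hA
    refine ⟨?_, ?_⟩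
    · change ((1 - P) * X * (1 - P) + A * P) * P = P * ((1 - P) * X * (1 - P) + A * P)
      have hAP' : A * P = P * A := hAP
      rw [add_mul, mul_add, mul_assoc _ _ P, hPQ, mul_zero, ← mul_assoc P, ← mul_assoc P, hQP,
        zero_mul, zero_mul, mul_assoc, hP, ← mul_assoc P, ← hAP', mul_assoc, hP]
    · change ((1 - P) * X * (1 - P) + A * P) * P ∈ N
      rw [add_mul, mul_assoc _ _ P, hPQ, mul_zero, zero_add, mul_assoc, hP]
      exact hAN

end Commutants

/-! ### Structure of an arbitrary `R`-beable algebra -/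

section BeableSubalgebras

variable {H : Type*} [NormedAddCommGroup H] [InnerProductSpace ℂ H] [CompleteSpace H]
  {R : Set (H →L[ℂ] H)} {M : Set H} {K : H →L[ℂ] H} {hK : IsDensityOperator K}
  {C : StarSubalgebra ℂ (H →L[ℂ] H)}

/-- Commutators in an `R`-beable algebra vanish on the cyclic subspace of the range of `K`. -/
theorem IsRBeable.commutator_mul_starProjection (hC : IsRBeable R (normalState K hK) C)
    (hR : ∀ A ∈ R, IsSelfAdjoint A) (hM : M ⊆ closure (Set.range K)) {a x : H →L[ℂ] H}
    (ha : a ∈ C) (hx : x ∈ C) :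
    (a * x - x * a) * (bicommutantSpan R M).starProjection = 0 := by
  -- The extra factor `y ∈ C` makes the subspace invariant under `C`, hence under `R`.
  let V : Submodule ℂ H := ⨅ y : C, ((a * x - x * a) * (y : H →L[ℂ] H)).ker
  have hmem : ∀ z, z ∈ V ↔ ∀ y ∈ C, (a * x - x * a) (y z) = 0 := by
    intro z
    simp only [V, Submodule.mem_iInf, Subtype.forall]
    rfl
  have hV : IsClosed (V : Set H) := by
    simp only [V, Submodule.coe_iInf]
    exact isClosed_iInter fun y => ContinuousLinearMap.isClosed_ker _
  have hran : Set.range K ⊆ V := by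
    rintro _ ⟨z, rfl⟩
    refine (hmem _).2 fun y hy => ?_
    have h := hK.mul_eq_zero_of_opTrace (hC.beable.apply_commutator ha hx hy)
    exact congrArg (fun T : H →L[ℂ] H => T z) h
  have hle : bicommutantSpan R M ≤ V := by
    refine bicommutantSpan_le hR hV (hM.trans (closure_minimal hran hV)) fun A hA z hz => ?_
    refine (hmem _).2 fun y hy => ?_
    exact (hmem z).1 hz (y * A) (mul_mem hy (hC.priv hA))
  ext z
  exact (hmem _).1 (hle (Submodule.starProjection_apply_mem _ z)) 1 (one_mem C)

theorem IsRBeable.conj_mem (hC : IsRBeable R (normalState K hK) C) {U T : H →L[ℂ] H}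
    (hU : U ∈ unitary (H →L[ℂ] H)) (hUR : U ∈ R.centralizer) (hUK : Commute U K) (hT : T ∈ C) :
    U * T * star U ∈ C := by
  have h := hC.definable U hU hUR (hK.invariant_of_commute hU hUK)
  rw [← SetLike.mem_coe, ← h]
  exact ⟨T, hT, rfl⟩

/-- The unitary that is multiplication by `z` in the range of a projection `P` and the identity on
its orthogonal complement. -/
theorem smul_add_one_sub_mem_unitary {A : Type*} [CStarAlgebra A] {P : A} (hP : P * P = P)
    (hP' : star P = P) {z : ℂ} (hz : star z * z = 1) : z • P + (1 - P) ∈ unitary A := by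
  constructor <;>
  · simp only [star_add, star_smul, star_sub, star_one, hP', add_mul, mul_add, smul_mul_assoc,
      mul_smul_comm, mul_sub, sub_mul, mul_one, one_mul, hP]
    match_scalars <;> first | ring1 | linear_combination hz

/-- An `R`-beable algebra is reduced by the cyclic subspace of the range of `K`. -/
theorem IsRBeable.commute_starProjection (hC : IsRBeable R (normalState K hK) C)
    (hR : ∀ A ∈ R, IsSelfAdjoint A) (hM : M ⊆ closure (Set.range K))
    (hKS : Set.range K ⊆ bicommutantSpan R M) {T : H →L[ℂ] H} (hT : T ∈ C) :
    Commute T (bicommutantSpan R M).starProjection := by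
  have hPR := starProjection_bicommutantSpan_mem_centralizer (M := M) hR
  have hcm := fun {a x : H →L[ℂ] H} => hC.commutator_mul_starProjection (a := a) (x := x) hR hM
  have hPP : (bicommutantSpan R M).starProjection * (bicommutantSpan R M).starProjection =
    (bicommutantSpan R M).starProjection := Submodule.isIdempotentElem_starProjection _
  have hPs : star (bicommutantSpan R M).starProjection = (bicommutantSpan R M).starProjection :=
    isSelfAdjoint_starProjection _
  have hPK := starProjection_mul_of_range_subset hKS
  have hKP := mul_starProjection_of_range_subset hK.isSelfAdjoint hKS
  set P := (bicommutantSpan R M).starProjection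
  have hconj : ∀ z : ℂ, star z * z = 1 → ∀ T ∈ C,
      (z • P + (1 - P)) * T * star (z • P + (1 - P)) ∈ C := by
    intro z hz T hT
    refine hC.conj_mem (smul_add_one_sub_mem_unitary hPP hPs hz) ?_ ?_ hT
    · intro A hA
      have := hPR A hA
      simp only [mul_add, add_mul, mul_sub, sub_mul, mul_smul_comm, smul_mul_assoc, this, one_mul,
        mul_one]
    · change (z • P + (1 - P)) * K = K * (z • P + (1 - P))
      simp only [mul_add, add_mul, mul_sub, sub_mul, mul_smul_comm, smul_mul_assoc, hPK, hKP,
        one_mul, mul_one]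
  have hcorner : ∀ T ∈ C, (1 - P) * T * P ∈ C := by
    intro T hT
    have h1 := hconj (-1) (by simp) T hT
    have h2 := hconj Complex.I (by simp) T hT
    -- Conjugation by `z P + (1 - P)` multiplies `P T (1 - P)` by `z` and `(1 - P) T P` by its
    -- conjugate. The value `z = -1` yields the sum of the corners, `z = I` their difference, and
    -- together they isolate one.
    have e : (1 - P) * T * P =
        (1 / 4 : ℂ) • (T - ((-1 : ℂ) • P + (1 - P)) * T * star ((-1 : ℂ) • P + (1 - P))) +
          (Complex.I / 2) • ((Complex.I • P + (1 - P)) * T * star (Complex.I • P + (1 - P)) -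
            (1 / 2 : ℂ) • (T + ((-1 : ℂ) • P + (1 - P)) * T * star ((-1 : ℂ) • P + (1 - P)))) := by
      simp only [star_add, star_smul, star_sub, star_one, hPs, add_mul, mul_add, smul_mul_assoc,
        mul_smul_comm, mul_sub, sub_mul, mul_one, one_mul, star_neg, Complex.star_def,
        Complex.conj_I]
      (match_scalars <;> ring_nf <;> simp [Complex.I_sq]); ring_nf
    rw [e]
    exact add_mem (C.smul_mem (sub_mem hT h1) _)
      (C.smul_mem (sub_mem h2 (C.smul_mem (add_mem hT h1) _)) _)
  have hzero : ∀ T ∈ C, (1 - P) * T * P = 0 := by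
    intro T hT
    set W := (1 - P) * T * P with hW
    have hWC : W ∈ C := hcorner T hT
    have hWP : W * P = W := by rw [hW, mul_assoc _ P, hPP]
    have hPW : P * W = 0 := by
      rw [hW, ← mul_assoc, ← mul_assoc, mul_sub, mul_one, hPP, sub_self, zero_mul, zero_mul]
    have hWP' : star W * P = 0 := by
      have := congrArg star hPW
      rwa [star_mul, hPs, star_zero] at this
    -- As `star W * P = 0` and `W * P = W`, the commutator of `star W` and `W` restricted to `S` is
    -- just `star W * W`.
    have h := hcm (star_mem hWC) hWC
    rw [sub_mul, mul_assoc (star W), mul_assoc W, hWP', mul_zero, sub_zero, hWP] at h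
    exact CStarRing.star_mul_self_eq_zero_iff W |>.1 h
  have h1 := hzero T hT
  have h2 := congrArg star (hzero _ (star_mem hT))
  simp only [star_mul, star_star, star_sub, star_zero, hPs, sub_mul, one_mul, sub_eq_zero] at h1 h2
  exact h1.trans ((mul_assoc _ _ _).trans h2.symm)

/-- Preserving the state means commuting with `K`. One inclusion for conjugates suffices, since
`star U` is admissible whenever `U` is. -/
theorem isRBeable_of_reduces (hK : IsDensityOperator K) (hR : ∀ A ∈ R, IsSelfAdjoint A)
    {S : Submodule ℂ H} [CompleteSpace S] (hKS : Set.range K ⊆ S)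
    (B : StarSubalgebra ℂ (H →L[ℂ] H)) (hcl : IsClosed (B : Set (H →L[ℂ] H)))
    (hB : ∀ T ∈ B, Commute T S.starProjection)
    (hcomm : ∀ T ∈ B, ∀ T' ∈ B, Commute (T * S.starProjection) (T' * S.starProjection))
    (hRB : R ⊆ B)
    (hU : ∀ U ∈ unitary (H →L[ℂ] H), U ∈ R.centralizer → Commute U K → ∀ T ∈ B,
      U * T * star U ∈ B) :
    IsRBeable R (normalState K hK) B where
  beable := isBeable_of_reduces hK S (mul_starProjection_of_range_subset hK.isSelfAdjoint hKS)
    B hcl hB hcomm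
  priv := hRB
  definable := by
    intro U hUu hUR hinv
    have hUK := hK.commute_of_invariant hUu hinv
    apply Set.Subset.antisymm
    · rintro _ ⟨T, hT, rfl⟩
      exact hU U hUu hUR hUK T hT
    · intro T hT
      have hUK' : Commute (star U) K := by
        have := hUK.star_star
        rwa [hK.isSelfAdjoint.star_eq] at this
      have hUR' : star U ∈ R.centralizer :=
        Set.star_mem_centralizer' (fun A hA => by rwa [(hR A hA).star_eq]) hUR
      have h := hU (star U) (Unitary.star_mem hUu) hUR' hUK' T hT
      rw [star_star] at h
      refine ⟨_, h, ?_⟩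
      change U * (star U * T * U) * star U = T
      rw [← mul_assoc, ← mul_assoc, Unitary.mul_star_self_of_mem hUu, one_mul, mul_assoc,
        Unitary.mul_star_self_of_mem hUu, mul_one]

end BeableSubalgebras

/-! ### Elements commuting with their unitary conjugates -/

section SecondCommutator

variable {A : Type*} [CStarAlgebra A]

/-- If `T` commutes with its conjugates by the unitaries of a commutant, then it commutes with
its commutators with the self-adjoint elements. -/
theorem commute_commutator_of_commute_conj {Z : Set A} {T : A}
    (hT : ∀ U ∈ unitary A, U ∈ Z.centralizer → Commute T (U * T * star U)) {b : A}
    (hb : b ∈ Z.centralizer) (hbs : IsSelfAdjoint b) : Commute T (T * b - b * T) := by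
  let _ : NormedAlgebra ℚ A := .restrictScalars ℚ ℂ A
  let x : A := Complex.I • b
  let V : ℝ → A := fun t => NormedSpace.exp (t • x)
  let W : ℝ → A := fun t => NormedSpace.exp (t • -x)
  have hx : x ∈ skewAdjoint A := hbs.smul_mem_skewAdjoint Complex.conj_I
  have hsx : star x = -x := skewAdjoint.mem_iff.1 hx
  have hu : ∀ t, V t ∈ unitary A := fun t =>
    NormedSpace.exp_mem_unitary_of_mem_skewAdjoint (skewAdjoint.smul_mem t hx)
  have hW : ∀ t, star (V t) = W t := by
    intro t
    simp only [V, W]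
    rw [NormedSpace.star_exp, star_smul, hsx, star_trivial]
  have hc : ∀ t, V t ∈ Z.centralizer := by
    intro t a ha
    have h : Commute a b := hb a ha
    exact (((h.smul_right Complex.I).smul_right t).exp_right)
  have hV0 : V 0 = 1 := by simp [V]
  have hW0 : W 0 = 1 := by simp [W]
  have hVd : HasDerivAt V x 0 := by
    have := hasDerivAt_exp_smul_const (𝕂 := ℝ) x 0
    simpa using this
  have hWd : HasDerivAt W (-x) 0 := by
    have := hasDerivAt_exp_smul_const (𝕂 := ℝ) (-x) 0
    simpa only [zero_smul, NormedSpace.exp_zero, one_mul] using this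
  have hd := (hVd.mul_const T).mul hWd
  simp only [hV0, hW0, mul_one, one_mul] at hd
  have hd' := (hd.const_mul T).sub (hd.mul_const T)
  have h0 : (fun t => T * (V t * T * W t) - V t * T * W t * T) = fun _ => 0 := by
    funext t
    rw [← hW, sub_eq_zero]
    exact hT _ (hu t) (hc t)
  have h1 := hd'.unique (f := fun t => T * (V t * T * W t) - V t * T * W t * T)
    (by rw [h0]; exact hasDerivAt_const _ _)
  have h2 : Complex.I • (T * (T * b - b * T) - (T * b - b * T) * T) = 0 := by
    rw [← neg_eq_zero, ← h1]
    simp only [x, mul_add, add_mul, mul_sub, sub_mul, smul_mul_assoc, mul_smul_comm, mul_neg,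
      neg_mul, mul_assoc]
    module
  exact sub_eq_zero.1 ((smul_eq_zero.1 h2).resolve_left Complex.I_ne_zero)

/-- A self-adjoint element that commutes with its conjugates by the unitaries of a commutant lies
in the double commutant. -/
theorem mem_centralizer_centralizer_of_commute_conj {Z : Set A} (hZ : ∀ a ∈ Z, star a ∈ Z) {T : A}
    (hTs : IsSelfAdjoint T)
    (hT : ∀ U ∈ unitary A, U ∈ Z.centralizer → Commute T (U * T * star U)) :
    T ∈ Z.centralizer.centralizer := by
  have hsa : ∀ b ∈ Z.centralizer, IsSelfAdjoint b → Commute b T := by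
    intro b hb hbs
    have h1 : Commute T (T * b - b * T) := commute_commutator_of_commute_conj hT hb hbs
    have hbb : IsSelfAdjoint (b * b) := by
      change star (b * b) = b * b
      rw [star_mul, hbs.star_eq]
    have h2 : Commute T (T * (b * b) - b * b * T) :=
      commute_commutator_of_commute_conj hT (Set.mul_mem_centralizer hb hb) hbb
    set D := T * b - b * T with hD
    -- `[T, b²] = D b + b D` commutes with `T`, and so does `D`; hence `0 = [T, D b + b D] = 2 D²`.
    -- Since `D` is skew-adjoint, `D = 0`.
    have e : T * (b * b) - b * b * T = D * b + b * D := by rw [hD]; noncomm_ring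
    have e2 : (2 : ℂ) • (D * D) = 0 := by
      have h3 := h2.eq
      rw [e] at h3
      have h4 : T * (D * b + b * D) = D * (T * b) + (T * b) * D := by
        rw [mul_add, ← mul_assoc, h1.eq, mul_assoc, mul_assoc]
      have h5 : (D * b + b * D) * T = D * (b * T) + (b * T) * D := by
        rw [add_mul, mul_assoc b D T, ← h1.eq, mul_assoc, mul_assoc]
      rw [h4, h5, ← sub_eq_zero] at h3
      have h6 : D * D = D * (T * b) - D * (b * T) := by rw [← mul_sub]
      have h7 : D * D = T * b * D - b * T * D := by rw [← sub_mul]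
      rw [← h3, two_smul]
      exact (congrArg₂ (· + ·) h6 h7).trans (by abel)
    have e3 : D * D = 0 := (smul_eq_zero.1 e2).resolve_left two_ne_zero
    have hDs : star D = -D := by
      rw [hD, star_sub, star_mul, star_mul, hTs.star_eq, hbs.star_eq, neg_sub]
    have : D = 0 := by
      rw [← CStarRing.star_mul_self_eq_zero_iff, hDs, neg_mul, e3, neg_zero]
    exact (sub_eq_zero.1 (hD ▸ this)).symm
  intro b hb
  have hb' : star b ∈ Z.centralizer := Set.star_mem_centralizer' hZ hb
  have hmem : ∀ (c : ℂ) (d : A), d ∈ Z.centralizer → c • d ∈ Z.centralizer := fun c d hd a ha => by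
    rw [mul_smul_comm, smul_mul_assoc, hd a ha]
  have h1 := hsa (realPart b) (by
    rw [realPart_apply_coe, ← Complex.coe_smul]
    exact hmem _ _ (Set.add_mem_centralizer hb hb')) (realPart b).2
  have h2 := hsa (imaginaryPart b) (by
    rw [imaginaryPart_apply_coe, ← Complex.coe_smul]
    exact hmem _ _ (hmem _ _ (by
      rw [sub_eq_add_neg]
      exact Set.add_mem_centralizer hb (Set.neg_mem_centralizer hb')))) (imaginaryPart b).2
  have h3 := h1.add_left (h2.smul_left Complex.I)
  rw [realPart_add_I_smul_imaginaryPart] at h3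
  exact h3

end SecondCommutator

/-! ### The commutant on a cyclic subspace -/

section Cyclic

variable {H : Type*} [NormedAddCommGroup H] [InnerProductSpace ℂ H] [CompleteSpace H]
  {R : Set (H →L[ℂ] H)}

/-- Each vector of a cyclic subspace of a vector is a limit of `A v`, with `A` in the bicommutant. -/
theorem exists_tendsto_of_mem_bicommutantSpan {v x : H} (hx : x ∈ bicommutantSpan R {v}) :
    ∃ A : ℕ → H →L[ℂ] H, (∀ n, A n ∈ R.centralizer.centralizer) ∧
      Filter.Tendsto (fun n => A n v) Filter.atTop (nhds x) := by
  -- `R''` is a linear space, so the vectors `A v` already form a subspace.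
  have hsub : (Submodule.span ℂ {y : H | ∃ A ∈ R.centralizer.centralizer, ∃ x ∈ ({v} : Set H),
      y = A x} : Set H) ⊆ (fun A : H →L[ℂ] H => A v) '' R.centralizer.centralizer := by
    intro y hy
    induction hy using Submodule.span_induction with
    | mem y hy =>
      obtain ⟨A, hA, x, rfl, rfl⟩ := hy
      exact ⟨A, hA, rfl⟩
    | zero => exact ⟨0, Set.zero_mem_centralizer, rfl⟩
    | add y z _ _ hy hz =>
      obtain ⟨A, hA, rfl⟩ := hy
      obtain ⟨B, hB, rfl⟩ := hz
      exact ⟨A + B, Set.add_mem_centralizer hA hB, rfl⟩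
    | smul c y _ hy =>
      obtain ⟨A, hA, rfl⟩ := hy
      refine ⟨c • A, fun B hB => ?_, rfl⟩
      rw [mul_smul_comm, smul_mul_assoc, hA B hB]
  obtain ⟨y, hy, hyx⟩ := mem_closure_iff_seq_limit.1 hx
  choose A hA hAy using fun n => hsub (hy n)
  exact ⟨A, hA, by simpa only [hAy] using hyx⟩

/-- On a cyclic subspace of a commuting family, the commutant is commutative. -/
theorem mul_comm_of_cyclic_of_isSelfAdjoint (hR : ∀ A ∈ R, IsSelfAdjoint A)
    (hRc : ∀ A ∈ R, ∀ B ∈ R, Commute A B) {v : H} {X Y : H →L[ℂ] H}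
    (hX : X ∈ R.centralizer) (hY : Y ∈ R.centralizer) (hXs : IsSelfAdjoint X)
    (hXS : ∀ x ∈ bicommutantSpan R {v}, X x ∈ bicommutantSpan R {v})
    (hYS : ∀ x ∈ bicommutantSpan R {v}, Y x ∈ bicommutantSpan R {v}) :
    ∀ x ∈ bicommutantSpan R {v}, X (Y x) = Y (X x) := by
  have hRs : ∀ A ∈ R, star A ∈ R := fun A hA => by rwa [(hR A hA).star_eq]
  have hstar : ∀ {A : H →L[ℂ] H}, A ∈ R.centralizer.centralizer →
      star A ∈ R.centralizer.centralizer := fun hA =>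
    Set.star_mem_centralizer' (fun _ hB => Set.star_mem_centralizer' hRs hB) hA
  have hcomm : ∀ {A B : H →L[ℂ] H}, A ∈ R.centralizer.centralizer →
      B ∈ R.centralizer.centralizer → Commute A B := fun hA hB =>
    Set.centralizer_centralizer_comm_of_comm hRc _ hA _ hB
  have happ : ∀ {A B : H →L[ℂ] H}, B * A = A * B → ∀ x, A (B x) = B (A x) := fun h x =>
    (congrArg (fun T : H →L[ℂ] H => T x) h).symm
  have hv : v ∈ bicommutantSpan R {v} := subset_bicommutantSpan rfl
  have key : X (Y v) = Y (X v) := by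
    obtain ⟨A, hA, hlim⟩ := exists_tendsto_of_mem_bicommutantSpan (hXS v hv)
    have hlim' : Filter.Tendsto (fun n => star (A n) v) Filter.atTop (nhds (X v)) := by
      rw [tendsto_iff_norm_sub_tendsto_zero] at hlim ⊢
      refine hlim.congr fun n => ?_
      have hAX : Commute (A n) X := (hA n X hX).symm
      have hAX' : Commute (star (A n)) X := (hstar (hA n) X hX).symm
      -- `R''` is abelian and commutes with `X`, so `A n - X` is normal; thus `star (A n) v`
      -- approaches `X v` as fast as `A n v` does.
      have hn : IsStarNormal (A n - X) := ⟨by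
        rw [star_sub, hXs.star_eq]
        exact ((hcomm (hstar (hA n)) (hA n)).sub_right hAX').sub_left
          (hAX.symm.sub_right (Commute.refl X))⟩
      have := ContinuousLinearMap.isStarNormal_iff_norm_eq_adjoint.1 hn v
      rw [← ContinuousLinearMap.star_eq_adjoint, star_sub, hXs.star_eq] at this
      exact this
    -- In the approximants `A n` can be moved across the inner product, past both `Y` and `B`; the
    -- limit moves `X` in the same way.
    have hinner : ∀ B ∈ R.centralizer.centralizer, ⟪Y (X v), B v⟫_ℂ = ⟪X (Y v), B v⟫_ℂ := by
      intro B hB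
      have l1 : Filter.Tendsto (fun n => ⟪Y (A n v), B v⟫_ℂ) Filter.atTop
          (nhds ⟪Y (X v), B v⟫_ℂ) :=
        ((Y.continuous.tendsto _).comp hlim).inner tendsto_const_nhds
      have l2 : Filter.Tendsto (fun n => ⟪Y v, B (star (A n) v)⟫_ℂ) Filter.atTop
          (nhds ⟪Y v, B (X v)⟫_ℂ) :=
        tendsto_const_nhds.inner ((B.continuous.tendsto _).comp hlim')
      have e : (fun n => ⟪Y (A n v), B v⟫_ℂ) = fun n => ⟪Y v, B (star (A n) v)⟫_ℂ := by
        funext n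
        rw [happ (hA n Y hY).symm v, happ (hcomm (hstar (hA n)) hB).eq,
          ContinuousLinearMap.star_eq_adjoint, ContinuousLinearMap.adjoint_inner_right]
      rw [e] at l1
      rw [tendsto_nhds_unique l1 l2, ← happ (hB X hX).symm v]
      exact (hXs.isSymmetric _ _).symm
    have hz : X (Y v) - Y (X v) ∈ bicommutantSpan R {v} :=
      sub_mem (hXS _ (hYS _ hv)) (hYS _ (hXS _ hv))
    have horth : ∀ z ∈ bicommutantSpan R {v}, ⟪X (Y v) - Y (X v), z⟫_ℂ = 0 := by
      intro z hz
      obtain ⟨B, hB, hBz⟩ := exists_tendsto_of_mem_bicommutantSpan hz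
      refine tendsto_nhds_unique ((tendsto_const_nhds.inner hBz)) ?_
      refine tendsto_const_nhds.congr fun n => ?_
      rw [inner_sub_left, hinner _ (hB n), sub_self]
    exact sub_eq_zero.1 (inner_self_eq_zero.1 (horth _ hz))
  intro x hx
  obtain ⟨B, hB, hBx⟩ := exists_tendsto_of_mem_bicommutantSpan hx
  refine tendsto_nhds_unique (((X * Y).continuous.tendsto _).comp hBx) ?_
  refine (((Y * X).continuous.tendsto _).comp hBx).congr fun n => ?_
  simp only [Function.comp_apply, mul_apply_eq_comp]
  rw [← happ (hB n X hX), ← happ (hB n Y hY), ← happ (hB n Y hY), ← happ (hB n X hX), key]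

/-- The self-adjoint case applies to the real and imaginary parts of `X`, which are again reduced by
the cyclic subspace. -/
theorem commute_of_cyclic (hR : ∀ A ∈ R, IsSelfAdjoint A)
    (hRc : ∀ A ∈ R, ∀ B ∈ R, Commute A B) {v : H} {X Y : H →L[ℂ] H}
    (hX : X ∈ R.centralizer) (hY : Y ∈ R.centralizer)
    (hXP : Commute X (bicommutantSpan R {v}).starProjection)
    (hYP : Commute Y (bicommutantSpan R {v}).starProjection) :
    Commute (X * (bicommutantSpan R {v}).starProjection)
      (Y * (bicommutantSpan R {v}).starProjection) := by
  have hRs : ∀ A ∈ R, star A ∈ R := fun A hA => by rwa [(hR A hA).star_eq]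
  have hPR := starProjection_bicommutantSpan_mem_centralizer (M := {v}) hR
  have hPs : star (bicommutantSpan R {v}).starProjection =
    (bicommutantSpan R {v}).starProjection := isSelfAdjoint_starProjection _
  have hPP : (bicommutantSpan R {v}).starProjection * (bicommutantSpan R {v}).starProjection =
    (bicommutantSpan R {v}).starProjection := Submodule.isIdempotentElem_starProjection _
  have hinv : ∀ {T : H →L[ℂ] H}, Commute T (bicommutantSpan R {v}).starProjection →
      ∀ x ∈ bicommutantSpan R {v}, T x ∈ bicommutantSpan R {v} := by
    intro T hT x hx
    have h := congrArg (fun T : H →L[ℂ] H => T x) hT.eq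
    simp only [mul_apply_eq_comp, Submodule.starProjection_eq_self_iff.2 hx] at h
    rw [h]
    exact Submodule.starProjection_apply_mem _ _
  have hsa : ∀ T ∈ R.centralizer, IsSelfAdjoint T →
      Commute T (bicommutantSpan R {v}).starProjection →
      T * Y * (bicommutantSpan R {v}).starProjection =
        Y * T * (bicommutantSpan R {v}).starProjection := by
    intro T hT hTs hTP
    ext x
    exact mul_comm_of_cyclic_of_isSelfAdjoint hR hRc hT hY hTs (hinv hTP) (hinv hYP) _
      (Submodule.starProjection_apply_mem _ x)
  set P := (bicommutantSpan R {v}).starProjection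
  have hX' : star X ∈ R.centralizer := Set.star_mem_centralizer' hRs hX
  have hX'P : Commute (star X) P := by
    have := hXP.star_star
    rwa [hPs] at this
  have hmem : ∀ (c : ℂ) (d : H →L[ℂ] H), d ∈ R.centralizer → c • d ∈ R.centralizer :=
    fun c d hd a ha => by rw [mul_smul_comm, smul_mul_assoc, hd a ha]
  have h1 := hsa (realPart X) (by
    rw [realPart_apply_coe, ← Complex.coe_smul]
    exact hmem _ _ (Set.add_mem_centralizer hX hX')) (realPart X).2 (by
    rw [realPart_apply_coe]
    exact (hXP.add_left hX'P).smul_left _)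
  have h2 := hsa (imaginaryPart X) (by
    rw [imaginaryPart_apply_coe, ← Complex.coe_smul, sub_eq_add_neg]
    exact hmem _ _ (hmem _ _ (Set.add_mem_centralizer hX (Set.neg_mem_centralizer hX'))))
    (imaginaryPart X).2 (by
    rw [imaginaryPart_apply_coe]
    exact ((hXP.sub_left hX'P).smul_left _).smul_left _)
  have h3 : X * Y * P = Y * X * P := by
    rw [← realPart_add_I_smul_imaginaryPart X]
    simp only [add_mul, mul_add, smul_mul_assoc, mul_smul_comm, h1, h2]
  change X * P * (Y * P) = Y * P * (X * P)
  rw [mul_assoc X, ← mul_assoc P, ← hYP.eq, mul_assoc Y P, hPP, ← mul_assoc X, h3, mul_assoc Y P,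
    ← mul_assoc P, ← hXP.eq, mul_assoc X P, hPP, mul_assoc]

end Cyclic

/-! ### Extending operators from a subspace to the bicommutant -/

section Extension

variable {H : Type*} [NormedAddCommGroup H] [InnerProductSpace ℂ H] [CompleteSpace H]
  {R : Set (H →L[ℂ] H)}

/-- A linear map dominated by another one into a Hilbert space factors through it. -/
theorem exists_factor_of_norm_le {E : Type*} [AddCommGroup E] [Module ℂ E] (e f : E →ₗ[ℂ] H)
    (c : ℝ) (h : ∀ z, ‖f z‖ ≤ c * ‖e z‖) :
    ∃ A : H →L[ℂ] H, (∀ z, A (e z) = f z) ∧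
      A * (LinearMap.range e).topologicalClosure.starProjection = A := by
  set V := (LinearMap.range e).topologicalClosure with hV
  have heV : ∀ z, e z ∈ V := fun z => Submodule.le_topologicalClosure _ ⟨z, rfl⟩
  let e' : E →ₗ[ℂ] V := e.codRestrict V heV
  have hdense : DenseRange e' := by
    intro x
    rw [closure_subtype]
    have : ((↑) '' Set.range e' : Set H) = LinearMap.range e := by
      ext y
      constructor
      · rintro ⟨_, ⟨z, rfl⟩, rfl⟩
        exact ⟨z, rfl⟩
      · rintro ⟨z, rfl⟩
        exact ⟨_, ⟨z, rfl⟩, rfl⟩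
    rw [this]
    exact x.2
  refine ⟨f.extendOfNorm e' ∘L V.orthogonalProjectionOnto, fun z => ?_, ?_⟩
  · have h1 : V.orthogonalProjectionOnto (e z) = e' z :=
      Submodule.orthogonalProjectionOnto_mem_subspace_eq_self (e' z)
    rw [ContinuousLinearMap.comp_apply, h1]
    exact LinearMap.extendOfNorm_eq hdense ⟨c, h⟩ z
  · ext x
    have h2 : V.orthogonalProjectionOnto (V.starProjection x) = V.orthogonalProjectionOnto x :=
      Submodule.orthogonalProjectionOnto_mem_subspace_eq_self _
    rw [mul_apply_eq_comp, ContinuousLinearMap.comp_apply, h2]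
    rfl

/-- The map `∑ X ⊗ s ↦ ∑ X T s` on finite formal sums with `X` in a set of operators. -/
noncomputable def amplify (Z : Set (H →L[ℂ] H)) (T : H →L[ℂ] H) : (Z →₀ H) →ₗ[ℂ] H :=
  Finsupp.lsum ℂ fun X : Z => ((X : H →L[ℂ] H) * T).toLinearMap

theorem amplify_single (Z : Set (H →L[ℂ] H)) (T : H →L[ℂ] H) (X : Z) (s : H) :
    amplify Z T (Finsupp.single X s) = (X : H →L[ℂ] H) (T s) := by
  simp [amplify]

/-- Supplies the Gram identities behind the norm bound: all of `T` is moved to the right-hand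
argument. -/
theorem inner_amplify {Z : Set (H →L[ℂ] H)} {P T : H →L[ℂ] H}
    (h : ∀ X ∈ Z, ∀ Y ∈ Z, star T * (star X * Y) * T = star P * (star X * Y) * (star T * T))
    (z z' : Z →₀ H) :
    ⟪amplify Z T z, amplify Z T z'⟫_ℂ = ⟪amplify Z P z, amplify Z (star T * T) z'⟫_ℂ := by
  induction z using Finsupp.induction_linear with
  | zero => simp
  | add z w hz hw => rw [map_add, map_add, inner_add_left, inner_add_left, hz, hw]
  | single X s =>
    induction z' using Finsupp.induction_linear with
    | zero => simp
    | add z w hz hw => rw [map_add, map_add, inner_add_right, inner_add_right, hz, hw]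
    | single Y t =>
      simp only [amplify_single]
      have e := congrArg (fun A : H →L[ℂ] H => ⟪s, A t⟫_ℂ) (h X X.2 Y Y.2)
      simpa only [mul_apply_eq_comp, ContinuousLinearMap.star_eq_adjoint,
        ContinuousLinearMap.adjoint_inner_right] using e

/-- The defect operator `Q₀ = (‖T‖² - T⋆ T)^(1/2)` commutes with the same compressions as `T` and
`star T`, so `‖T‖² ‖∑ X P s‖² - ‖∑ X T s‖² = ‖∑ X Q₀ P s‖² ≥ 0`. -/
theorem norm_amplify_le {Z : Set (H →L[ℂ] H)} {P T : H →L[ℂ] H} (hPs : star P = P)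
    (hPP : P * P = P) (hPT : P * T = T) (hTP : T * P = T)
    (hT : ∀ X ∈ Z, ∀ Y ∈ Z, Commute T (P * (star X * Y) * P))
    (hT' : ∀ X ∈ Z, ∀ Y ∈ Z, Commute (star T) (P * (star X * Y) * P)) (z : Z →₀ H) :
    ‖amplify Z T z‖ ≤ ‖T‖ * ‖amplify Z P z‖ := by
  have hPT' : star T * P = star T := by
    have := congrArg star hPT
    rwa [star_mul, hPs] at this
  have hTP' : P * star T = star T := by
    have := congrArg star hTP
    rwa [star_mul, hPs] at this
  let D : H →L[ℂ] H := algebraMap ℝ (H →L[ℂ] H) (‖T‖ ^ 2) - star T * T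
  have hD : 0 ≤ D := sub_nonneg.2 CStarAlgebra.star_mul_le_algebraMap_norm_sq
  let Q₀ := CFC.sqrt D
  have hQ₀ : Q₀ * Q₀ = D := CFC.sqrt_mul_sqrt_self D hD
  have hQ₀s : star Q₀ = Q₀ := (CFC.sqrt_nonneg D).isSelfAdjoint.star_eq
  have hcomm : ∀ {B : H →L[ℂ] H}, Commute (star T * T) B → Commute Q₀ B := by
    intro B hB
    have : Commute D B := Commute.sub_left (Algebra.commutes _ B) hB
    exact this.cfcₙ_nnreal _
  have hQP : Commute Q₀ P := hcomm (by
    change star T * T * P = P * (star T * T)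
    rw [mul_assoc, hTP, ← mul_assoc, hTP'])
  have hQX : ∀ X ∈ Z, ∀ Y ∈ Z, Commute Q₀ (P * (star X * Y) * P) := fun X hX Y hY =>
    hcomm ((hT' X hX Y hY).mul_left (hT X hX Y hY))
  have hQs : star (Q₀ * P) = Q₀ * P := by rw [star_mul, hPs, hQ₀s, hQP.eq]
  have h1 := inner_amplify (Z := Z) (P := P) (T := T) (fun X hX Y hY => by
    calc star T * (star X * Y) * T = star T * (P * (star X * Y) * P) * T := by
          simp only [mul_assoc, hPT]
          rw [← mul_assoc (star T) P, hPT']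
      _ = star P * (star X * Y) * (star T * T) := by
          rw [(hT' X hX Y hY).eq, hPs, mul_assoc _ (star T), mul_assoc _ P, ← mul_assoc P (star T),
            hTP']) z z
  have h2 := inner_amplify (Z := Z) (P := P) (T := Q₀ * P) (fun X hX Y hY => by
    rw [hQs, hPs]
    calc Q₀ * P * (star X * Y) * (Q₀ * P) = Q₀ * P * (star X * Y) * (P * Q₀) :=
          congrArg (Q₀ * P * (star X * Y) * ·) hQP.eq
      _ = Q₀ * (P * (star X * Y) * P) * Q₀ := by simp only [mul_assoc]
      _ = P * (star X * Y) * (P * Q₀ * Q₀) := by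
          rw [(hQX X hX Y hY).eq]; simp only [mul_assoc]
      _ = P * (star X * Y) * (Q₀ * P * (Q₀ * P)) := by
          rw [hQP.eq, mul_assoc P Q₀ (P * Q₀), ← mul_assoc Q₀ P, hQP.eq, mul_assoc P Q₀ Q₀,
            ← mul_assoc P P, hPP]) z z
  have hsq : star (Q₀ * P) * (Q₀ * P) = ((‖T‖ ^ 2 : ℝ) : ℂ) • P - star T * T := by
    rw [hQs, mul_assoc, ← mul_assoc P, ← hQP.eq, mul_assoc Q₀ P, hPP, ← mul_assoc, hQ₀, sub_mul,
      mul_assoc, hTP, ← Algebra.smul_def, Complex.coe_smul]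
  have hlin : amplify Z (((‖T‖ ^ 2 : ℝ) : ℂ) • P - star T * T) z =
      ((‖T‖ ^ 2 : ℝ) : ℂ) • amplify Z P z - amplify Z (star T * T) z := by
    clear h1 h2
    induction z using Finsupp.induction_linear with
    | zero => simp
    | add z w hz hw =>
      rw [map_add, map_add, map_add, hz, hw, smul_add]
      abel
    | single X s => simp [amplify_single]
  rw [hsq, hlin, inner_sub_right, ← h1, inner_smul_right, inner_self_eq_norm_sq_to_K,
    inner_self_eq_norm_sq_to_K, inner_self_eq_norm_sq_to_K] at h2
  have h3 : ‖amplify Z (Q₀ * P) z‖ ^ 2 =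
      ‖T‖ ^ 2 * ‖amplify Z P z‖ ^ 2 - ‖amplify Z T z‖ ^ 2 := by
    apply Complex.ofReal_injective
    push_cast at h2 ⊢
    exact h2
  have h4 : ‖amplify Z T z‖ ^ 2 ≤ (‖T‖ * ‖amplify Z P z‖) ^ 2 := by
    rw [mul_pow]
    linarith [sq_nonneg ‖amplify Z (Q₀ * P) z‖]
  exact le_of_sq_le_sq h4 (by positivity)

/-- An operator on the range of a projection `P` that commutes with the compression of a commutant
to the range extends to an element of the bicommutant. -/
theorem exists_mem_bicommutant_mul_eq {R : Set (H →L[ℂ] H)} (hR : ∀ A ∈ R, star A ∈ R)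
    {P T : H →L[ℂ] H} (hPs : star P = P) (hPP : P * P = P) (hPT : P * T = T) (hTP : T * P = T)
    (hT : ∀ X ∈ R.centralizer, Commute T (P * X * P)) :
    ∃ A ∈ R.centralizer.centralizer, A * P = T := by
  have hmem : ∀ X ∈ R.centralizer, star X ∈ R.centralizer := fun X hX =>
    Set.star_mem_centralizer' hR hX
  have hT' : ∀ X ∈ R.centralizer, Commute (star T) (P * X * P) := by
    intro X hX
    have := (hT _ (hmem X hX)).star_star
    simpa only [star_mul, star_star, hPs, ← mul_assoc] using this
  -- `A` sends `∑ X P s` to `∑ X T s` for `X ∈ R'` and vanishes on the orthogonal complement of such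
  -- sums.
  obtain ⟨A, hA, hAV⟩ := exists_factor_of_norm_le (amplify R.centralizer P)
    (amplify R.centralizer T) ‖T‖ (norm_amplify_le hPs hPP hPT hTP
      (fun X hX Y hY => hT _ (Set.mul_mem_centralizer (hmem X hX) hY))
      (fun X hX Y hY => hT' _ (Set.mul_mem_centralizer (hmem X hX) hY)))
  set V := (LinearMap.range (amplify R.centralizer P)).topologicalClosure
  -- Left multiplication by `X` acts on formal sums independently of `B`; with `B = P` and `B = T`
  -- this makes `A` commute with `X` on `V`.
  have hshift : ∀ X ∈ R.centralizer, ∀ z : R.centralizer →₀ H, ∃ z' : R.centralizer →₀ H,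
      ∀ B : H →L[ℂ] H, X (amplify R.centralizer B z) = amplify R.centralizer B z' := by
    intro X hX z
    refine ⟨z.mapDomain fun Y : R.centralizer => ⟨X * (Y : H →L[ℂ] H), Set.mul_mem_centralizer hX Y.2⟩, fun B => ?_⟩
    induction z using Finsupp.induction_linear with
    | zero => simp
    | add z w hz hw => rw [map_add, map_add, hz, hw, Finsupp.mapDomain_add, map_add]
    | single Y s => simp [amplify_single, Finsupp.mapDomain_single]
  have hVinv : ∀ X ∈ R.centralizer, ∀ x ∈ V, X x ∈ V := by
    intro X hX x hx
    have hcl : IsClosed (V.comap (X : H →ₗ[ℂ] H) : Set H) :=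
      (Submodule.isClosed_topologicalClosure _).preimage X.continuous
    refine Submodule.topologicalClosure_minimal _ ?_ hcl hx
    rintro _ ⟨z, rfl⟩
    obtain ⟨z', hz'⟩ := hshift X hX z
    exact Submodule.le_topologicalClosure _ ⟨z', (hz' P).symm⟩
  refine ⟨A, fun X hX => ?_, ?_⟩
  · have hXV : Commute X V.starProjection :=
      commute_starProjection (hVinv X hX) (hVinv _ (hmem X hX))
    have hle : V ≤ (X * A - A * X).ker := by
      refine Submodule.topologicalClosure_minimal _ ?_ (X * A - A * X).isClosed_ker
      rintro _ ⟨z, rfl⟩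
      obtain ⟨z', hz'⟩ := hshift X hX z
      change X (A _) - A (X _) = 0
      rw [hA, hz', hz', hA, sub_self]
    have h0 : (X * A - A * X) * V.starProjection = 0 := by
      ext x
      exact hle (Submodule.starProjection_apply_mem _ x)
    rw [sub_mul, mul_assoc X, hAV, mul_assoc A, hXV.eq, ← mul_assoc A, hAV, sub_eq_zero] at h0
    exact h0
  · ext s
    -- The formal sum `1 ⊗ s` gives `A P s = T s`.
    have := hA (Finsupp.single ⟨1, Set.one_mem_centralizer⟩ s)
    rw [amplify_single, amplify_single] at this
    exact this

end Extension

/-! ### The greatest `R`-beable algebra in the two cases -/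

section MaximalBeable

variable {H : Type*} [NormedAddCommGroup H] [InnerProductSpace ℂ H] [CompleteSpace H]
  {R : Set (H →L[ℂ] H)} {K : H →L[ℂ] H}

theorem isMaximalRBeable_iff_of_isGreatest {A : Type*} [CStarAlgebra A] {R : Set A}
    {ρ : stateSpace A} {B : StarSubalgebra ℂ A} (hB : IsRBeable R ρ B)
    (h : ∀ C, IsRBeable R ρ C → C ≤ B) (C : StarSubalgebra ℂ A) :
    IsMaximalRBeable R ρ C ↔ C = B := by
  constructor
  · exact fun hC => le_antisymm (h C hC.1) (hC.2 hB (h C hC.1))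
  · rintro rfl
    exact ⟨hB, fun C hC _ => h C hC⟩

/-- Because `K ∈ R'`, the set `Z = R ∪ {K}` commutes and `Z''` is abelian. The admissible unitaries
are those of `Z'`; they preserve `S`, so `P ∈ Z''`, and conjugation by them fixes every `T P ∈ Z''`.
-/
theorem exists_isMaximalRBeable_of_mem_centralizer (hR : ∀ A ∈ R, IsSelfAdjoint A)
    (hRc : ∀ A ∈ R, ∀ B ∈ R, Commute A B) (hK : IsDensityOperator K) (hKR : K ∈ R.centralizer) :
    ∃ B : StarSubalgebra ℂ (H →L[ℂ] H),
      (B : Set (H →L[ℂ] H)) = orthogonalSum (bicommutantSpan R (closure (Set.range K)))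
        (vonNeumannGenerated (R ∪ {K})) ∧
      ∀ C : StarSubalgebra ℂ (H →L[ℂ] H), IsMaximalRBeable R (normalState K hK) C ↔ C = B := by
  set Z : Set (H →L[ℂ] H) := R ∪ {K} with hZdef
  have hZs : ∀ A ∈ Z, star A ∈ Z := by
    rintro A (hA | rfl)
    · exact Or.inl (by rwa [(hR A hA).star_eq])
    · exact Or.inr hK.isSelfAdjoint.star_eq
  have hZ's : ∀ A ∈ Z.centralizer, star A ∈ Z.centralizer := fun A hA =>
    Set.star_mem_centralizer' hZs hA
  have hZc : ∀ A ∈ Z, ∀ B ∈ Z, A * B = B * A := by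
    rintro A (hA | rfl) B (hB | rfl)
    · exact hRc A hA B hB
    · exact hKR A hA
    · exact (hKR B hB).symm
    · rfl
  have hZR : ∀ U ∈ Z.centralizer, U ∈ R.centralizer := fun U hU A hA => hU A (Or.inl hA)
  have hZK : ∀ U ∈ Z.centralizer, Commute U K := fun U hU => (hU K (Or.inr rfl)).symm
  have hZ : ∀ U ∈ R.centralizer, Commute U K → U ∈ Z.centralizer := by
    rintro U hU hUK A (hA | rfl)
    · exact hU A hA
    · exact hUK.symm
  let N := StarSubalgebra.centralizer ℂ Z.centralizer
  have hN : (N : Set (H →L[ℂ] H)) = Z.centralizer.centralizer :=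
    coe_starSubalgebra_centralizer hZ's
  have hNmem : ∀ T, T ∈ N ↔ T ∈ Z.centralizer.centralizer := fun T => by
    rw [← SetLike.mem_coe, hN]
  have hKS : Set.range K ⊆ bicommutantSpan R (closure (Set.range K)) :=
    subset_closure.trans subset_bicommutantSpan
  have hinv : ∀ X ∈ Z.centralizer, ∀ y ∈ bicommutantSpan R (closure (Set.range K)),
      X y ∈ bicommutantSpan R (closure (Set.range K)) := by
    intro X hX
    refine bicommutantSpan_le_comap fun A hA x hx => ?_
    have h := congrArg (fun T : H →L[ℂ] H => T x) (hA X (hZR X hX))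
    simp only [mul_apply_eq_comp] at h
    rw [h]
    refine apply_mem_bicommutantSpan hA ?_
    refine map_mem_closure X.continuous hx ?_
    rintro _ ⟨y, rfl⟩
    exact ⟨X y, (congrArg (fun T : H →L[ℂ] H => T y) (hZK X hX).eq).symm⟩
  have hP : (bicommutantSpan R (closure (Set.range K))).starProjection ∈
      Z.centralizer.centralizer := fun X hX =>
    commute_starProjection (hinv X hX) (hinv _ (hZ's X hX))
  have hPN := (hNmem _).2 hP
  have hPP : (bicommutantSpan R (closure (Set.range K))).starProjection *
      (bicommutantSpan R (closure (Set.range K))).starProjection =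
      (bicommutantSpan R (closure (Set.range K))).starProjection :=
    Submodule.isIdempotentElem_starProjection _
  have hZcc := Set.centralizer_centralizer_comm_of_comm hZc
  refine ⟨reducedBy _ N hPN, ?_, isMaximalRBeable_iff_of_isGreatest ?_ ?_⟩
  · rw [vonNeumannGenerated_eq hZs]
    refine coe_reducedBy_eq_orthogonalSum (fun A hA => ⟨hZcc _ hA _ hP, ?_⟩)
      fun T hT hTP _ => ⟨T, (hNmem T).1 hT, hTP⟩
    exact mul_mem ((hNmem A).2 hA) hPN
  · refine isRBeable_of_reduces hK hR hKS _ (isClosed_reducedBy ?_) (fun T hT => hT.1) ?_ ?_ ?_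
    · rw [hN]
      exact Set.isClosed_centralizer _
    · exact fun T hT T' hT' => hZcc _ ((hNmem _).1 hT.2) _ ((hNmem _).1 hT'.2)
    · intro A hA
      have hAZ : A ∈ Z.centralizer.centralizer :=
        Set.subset_centralizer_centralizer (Or.inl hA)
      exact ⟨hZcc _ hAZ _ hP, mul_mem ((hNmem A).2 hAZ) hPN⟩
    · intro U hU hUR hUK T hT
      have hUZ := hZ U hUR hUK
      have hUP : Commute U _ := hP U hUZ
      have hUP' : Commute (star U) _ := hP _ (hZ's U hUZ)
      refine ⟨(hUP.mul_left hT.1).mul_left hUP', ?_⟩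
      have h := (hNmem _).1 hT.2 U hUZ
      rw [mul_assoc, hUP'.eq, ← mul_assoc, mul_assoc U, h, mul_assoc,
        Unitary.mul_star_self_of_mem hU, mul_one]
      exact hT.2
  · intro C hC
    have hred := fun {T : H →L[ℂ] H} (hT : T ∈ C) => hC.commute_starProjection hR subset_rfl hKS hT
    have hcm := fun {a x : H →L[ℂ] H} (ha : a ∈ C) (hx : x ∈ C) =>
      hC.commutator_mul_starProjection hR subset_rfl ha hx
    set P := (bicommutantSpan R (closure (Set.range K))).starProjection
    have hsa : ∀ T ∈ C, IsSelfAdjoint T → T * P ∈ N := by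
      intro T hT hTs
      have hTP := hred hT
      refine (hNmem _).2 (mem_centralizer_centralizer_of_commute_conj hZs ?_ ?_)
      · change star (T * P) = T * P
        rw [star_mul, hTs.star_eq, (isSelfAdjoint_starProjection _).star_eq]
        exact hTP.eq.symm
      -- Both `T` and `U T U⋆` lie in `C`, so they commute on `S`.
      · intro U hU hUZ
        have hUP' : Commute (star U) P := hP _ (hZ's U hUZ)
        have hG := hC.conj_mem hU (hZR U hUZ) (hZK U hUZ) hT
        have hGP := hred hG
        have h0 := hcm hT hG
        have e : U * (T * P) * star U = U * T * star U * P := by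
          rw [mul_assoc (U * T), hUP'.eq, ← mul_assoc, ← mul_assoc]
        rw [e]
        set G := U * T * star U
        rw [sub_mul, sub_eq_zero] at h0
        change T * P * (G * P) = G * P * (T * P)
        rw [mul_assoc T, ← mul_assoc P, ← hGP.eq, mul_assoc G P, hPP, ← mul_assoc, h0,
          mul_assoc G P, ← mul_assoc P, ← hTP.eq, mul_assoc T P, hPP, mul_assoc]
    intro T hT
    refine ⟨hred hT, ?_⟩
    have h1 := hsa (realPart T) (by
      rw [realPart_apply_coe, ← Complex.coe_smul]
      exact C.smul_mem (add_mem hT (star_mem hT)) _) (realPart T).2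
    have h2 := hsa (imaginaryPart T) (by
      rw [imaginaryPart_apply_coe, ← Complex.coe_smul]
      exact C.smul_mem (C.smul_mem (sub_mem hT (star_mem hT)) _) _) (imaginaryPart T).2
    rw [← realPart_add_I_smul_imaginaryPart T, add_mul, smul_mul_assoc]
    exact add_mem h1 (N.smul_mem h2 _)

/-- The algebra is built with `R'` in place of `R''`: membership in `R'` is what the vanishing
commutators with `R` deliver, and cyclicity shows that both give the same operators on `S`. -/
theorem exists_isMaximalRBeable_of_eq_starProjection (hR : ∀ A ∈ R, IsSelfAdjoint A)
    (hRc : ∀ A ∈ R, ∀ B ∈ R, Commute A B) (hK : IsDensityOperator K) {v : H}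
    (hKv : K = (Submodule.span ℂ {v}).starProjection) :
    ∃ B : StarSubalgebra ℂ (H →L[ℂ] H),
      (B : Set (H →L[ℂ] H)) = orthogonalSum (bicommutantSpan R {v}) (vonNeumannGenerated R) ∧
      ∀ C : StarSubalgebra ℂ (H →L[ℂ] H), IsMaximalRBeable R (normalState K hK) C ↔ C = B := by
  have hRs : ∀ A ∈ R, star A ∈ R := fun A hA => by rwa [(hR A hA).star_eq]
  have hR's : ∀ A ∈ R.centralizer, star A ∈ R.centralizer := fun A hA =>
    Set.star_mem_centralizer' hRs hA
  have hRR' : R ⊆ R.centralizer := fun A hA B hB => hRc B hB A hA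
  have hR''R' : R.centralizer.centralizer ⊆ R.centralizer := Set.centralizer_subset hRR'
  let N := StarSubalgebra.centralizer ℂ R
  have hN : (N : Set (H →L[ℂ] H)) = R.centralizer := coe_starSubalgebra_centralizer hRs
  have hNmem : ∀ T, T ∈ N ↔ T ∈ R.centralizer := fun T => by
    rw [← SetLike.mem_coe, hN]
  have hv : v ∈ bicommutantSpan R {v} := subset_bicommutantSpan rfl
  have hKS : Set.range K ⊆ bicommutantSpan R {v} := by
    rintro _ ⟨x, rfl⟩
    have hle : Submodule.span ℂ {v} ≤ bicommutantSpan R {v} :=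
      Submodule.span_le.2 subset_bicommutantSpan
    rw [hKv]
    exact hle (Submodule.starProjection_apply_mem _ x)
  have hKvv : K v = v := by
    rw [hKv]
    exact Submodule.starProjection_eq_self_iff.2 (Submodule.mem_span_singleton_self v)
  have hM : ({v} : Set H) ⊆ closure (Set.range K) := by
    rintro _ rfl
    exact subset_closure ⟨_, hKvv⟩
  have hP := starProjection_bicommutantSpan_mem_centralizer (M := {v}) hR
  have hPs : star (bicommutantSpan R {v}).starProjection =
    (bicommutantSpan R {v}).starProjection := isSelfAdjoint_starProjection _
  have hPP : (bicommutantSpan R {v}).starProjection * (bicommutantSpan R {v}).starProjection =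
    (bicommutantSpan R {v}).starProjection := Submodule.isIdempotentElem_starProjection _
  have hcyc := fun {X Y : H →L[ℂ] H} => commute_of_cyclic (v := v) (X := X) (Y := Y) hR hRc
  have hUinv : ∀ U ∈ R.centralizer, Commute U K → ∀ y ∈ bicommutantSpan R {v},
      U y ∈ bicommutantSpan R {v} := by
    intro U hU hUK
    refine bicommutantSpan_le_comap fun A hA x hx => ?_
    obtain rfl : x = v := hx
    have h := congrArg (fun T : H →L[ℂ] H => T x) (hA U hU)
    simp only [mul_apply_eq_comp] at h
    -- Commuting with the projection onto the line of `x` makes `x` an eigenvector of `U`.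
    have hUx : U x ∈ Submodule.span ℂ {x} := by
      have h' := congrArg (fun T : H →L[ℂ] H => T x) hUK.eq
      simp only [mul_apply_eq_comp, hKvv] at h'
      rw [h', hKv]
      exact Submodule.starProjection_apply_mem _ _
    obtain ⟨c, hc⟩ := Submodule.mem_span_singleton.1 hUx
    rw [h, ← hc, map_smul]
    exact Submodule.smul_mem _ _ (apply_mem_bicommutantSpan hA rfl)
  have hUP : ∀ U ∈ R.centralizer, Commute U K →
      Commute U (bicommutantSpan R {v}).starProjection := by
    intro U hU hUK
    refine commute_starProjection (hUinv U hU hUK) (hUinv _ (hR's U hU) ?_)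
    have := hUK.star_star
    rwa [hK.isSelfAdjoint.star_eq] at this
  have hred := fun {C} (hC : IsRBeable R (normalState K hK) C) {T : H →L[ℂ] H} (hT : T ∈ C) =>
    hC.commute_starProjection hR hM hKS hT
  have hcm := fun {C} (hC : IsRBeable R (normalState K hK) C) {a x : H →L[ℂ] H} (ha : a ∈ C)
    (hx : x ∈ C) => hC.commutator_mul_starProjection hR hM ha hx
  have hPN := (hNmem _).2 hP
  refine ⟨reducedBy _ N hPN, ?_, isMaximalRBeable_iff_of_isGreatest ?_ ?_⟩
  · rw [vonNeumannGenerated_eq hRs]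
    refine coe_reducedBy_eq_orthogonalSum (fun A hA => ⟨(hA _ hP).symm, ?_⟩) ?_
    · exact mul_mem ((hNmem A).2 (hR''R' hA)) hPN
    · intro T hT hTP hPT
      -- The compressions `P X P` are themselves in `R'`, so cyclicity makes `T` commute with them.
      refine exists_mem_bicommutant_mul_eq hRs hPs hPP hPT hTP fun X hX => ?_
      set P := (bicommutantSpan R {v}).starProjection
      have hPXP : P * X * P ∈ R.centralizer :=
        Set.mul_mem_centralizer (Set.mul_mem_centralizer hP hX) hP
      have hXP : P * X * P * P = P * X * P := by rw [mul_assoc, hPP]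
      have hXP' : P * (P * X * P) = P * X * P := by rw [← mul_assoc, ← mul_assoc, hPP]
      have h := hcyc ((hNmem T).1 hT) hPXP (hTP.trans hPT.symm) (hXP.trans hXP'.symm)
      rwa [hTP, hXP] at h
  · refine isRBeable_of_reduces hK hR hKS _ (isClosed_reducedBy ?_) (fun T hT => hT.1) ?_ ?_ ?_
    · rw [hN]
      exact Set.isClosed_centralizer _
    · intro T hT T' hT'
      have h := hcyc ((hNmem _).1 hT.2) ((hNmem _).1 hT'.2)
        (hT.1.mul_left (Commute.refl _)) (hT'.1.mul_left (Commute.refl _))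
      rwa [mul_assoc, mul_assoc, hPP] at h
    · intro A hA
      exact ⟨hP A hA, mul_mem ((hNmem A).2 (hRR' hA)) hPN⟩
    · intro U hU hUR hUK T hT
      have hUP1 := hUP U hUR hUK
      have hUP2 : Commute (star U) _ := hPs ▸ hUP1.star_star
      refine ⟨(hUP1.mul_left hT.1).mul_left hUP2, ?_⟩
      rw [mul_assoc, hUP2.eq, ← mul_assoc, mul_assoc U]
      exact mul_mem (mul_mem ((hNmem U).2 hUR) hT.2) (star_mem ((hNmem U).2 hUR))
  · intro C hC T hT
    refine ⟨hred hC hT, (hNmem _).2 fun A hA => ?_⟩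
    have h := hcm hC (hC.priv hA) hT
    rw [sub_mul, sub_eq_zero] at h
    rw [← mul_assoc, h, mul_assoc, hP A hA, mul_assoc]

end MaximalBeable

theorem mainTheorem4 {H : Type*} [NormedAddCommGroup H] [InnerProductSpace ℂ H] [CompleteSpace H]
    (R : Set (H →L[ℂ] H)) (hRsa : ∀ A ∈ R, IsSelfAdjoint A)
    (hRcomm : ∀ A ∈ R, ∀ B ∈ R, Commute A B)
    (K : H →L[ℂ] H) (hK : IsDensityOperator K) :
    (K ∈ Set.centralizer R →
      ∃ B : StarSubalgebra ℂ (H →L[ℂ] H),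
        (B : Set (H →L[ℂ] H)) =
          orthogonalSum (bicommutantSpan R (closure (Set.range K)))
            (vonNeumannGenerated (R ∪ {K})) ∧
        ∀ C : StarSubalgebra ℂ (H →L[ℂ] H),
          IsMaximalRBeable R (normalState K hK) C ↔ C = B) ∧
    (∀ v : H, K = (Submodule.span ℂ {v}).starProjection →
      ∃ B : StarSubalgebra ℂ (H →L[ℂ] H),
        (B : Set (H →L[ℂ] H)) =
          orthogonalSum (bicommutantSpan R {v}) (vonNeumannGenerated R) ∧
        ∀ C : StarSubalgebra ℂ (H →L[ℂ] H),
          IsMaximalRBeable R (normalState K hK) C ↔ C = B) := by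
  exact ⟨exists_isMaximalRBeable_of_mem_centralizer hRsa hRcomm hK,
    fun _ hv => exists_isMaximalRBeable_of_eq_starProjection hRsa hRcomm hK hv⟩
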